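/- Let $Z$ be a Dedekind domain which is not a field, with field of fractions $Q$, let $K$ be a non-zero étale $Q$-algebra, and let $S$ be a $Z$-order in $K$, that is, a subring of $K$ which is also a $Z$-lattice (a finitely generated $Z$-submodule of $K$ containing a $Q$-basis of $K$). Let $\mathfrak p$ be a prime of $S$, that is, a prime ideal of $S$ which is also a $Z$-lattice in $K$ (equivalently, a maximal ideal of $S$). Let $\hat S_{\mathfrak p}=\varprojlim_n S/\mathfrak p^n$ be the completion of $S$ at $\mathfrak p$, let $S^t=\{x\in K : \mathrm{Tr}_{K/Q}(xS)\subseteq Z\}$ be the trace dual of $S$, and let $\hat S^t_{\mathfrak p}=S^t\otimes_S\hat S_{\mathfrak p}$ be its completion at $\mathfrak p$. Then $\hat S_{\mathfrak p}$ is a Cohen–Macaulay local ring of Krull dimension $1$; denote by $k$ its residue field. Moreover: (i) $\hat S^t_{\mathfrak p}$ is a canonical module of $\hat S_{\mathfrak p}$, that is, it is a finitely generated $\hat S_{\mathfrak p}$-module and $\dim_k \mathrm{Ext}^i_{\hat S_{\mathfrak p}}(k,\hat S^t_{\mathfrak p})$ is $1$ for $i=\dim \hat S_{\mathfrak p}=1$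 and $0$ for every other $i\ge 0$. (ii) The (Cohen–Macaulay) type $\dim_k\mathrm{Ext}^{\dim \hat S_{\mathfrak p}}_{\hat S_{\mathfrak p}}(k,\hat S_{\mathfrak p})=\dim_k\mathrm{Ext}^1_{\hat S_{\mathfrak p}}(k,\hat S_{\mathfrak p})$ of $\hat S_{\mathfrak p}$ equals $\dim_{S/\mathfrak p} S^t/\mathfrak p S^t$. -/

import Mathlib

open CategoryTheory

universe u v w

noncomputable section

namespace OrderType

section LocalAlgebra

/-! ### Ext of the residue field, depth, Cohen-Macaulay rings, canonical modules, type -/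

variable (R : Type u) [CommRing R] [IsLocalRing R]

/-- The group `Ext^i_R(k, M)`, where `k` is the residue field of the local ring `R`. -/
abbrev ExtResidue (M : Type u) [AddCommGroup M] [Module R M] (i : ℕ) : Type u :=
  Abelian.Ext (ModuleCat.of R (IsLocalRing.ResidueField R)) (ModuleCat.of R M) i

theorem extResidue_isTorsion (M : Type u) [AddCommGroup M] [Module R M] (i : ℕ) :
    Module.IsTorsionBySet R (ExtResidue R M i) (IsLocalRing.maximalIdeal R : Set R) := by
  rintro e ⟨r, hr⟩
  have h0 : r • 𝟙 (ModuleCat.of R (IsLocalRing.ResidueField R)) = 0 := by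
    ext x
    have hx : r • x = 0 := by
      rw [Algebra.smul_def, IsLocalRing.ResidueField.algebraMap_eq,
        (IsLocalRing.residue_eq_zero_iff r).2 hr, zero_mul]
    simpa using hx
  have h1 : r • e =
      (Abelian.Ext.mk₀ (r • 𝟙 (ModuleCat.of R (IsLocalRing.ResidueField R)))).comp e
        (zero_add i) := by
    simp [Abelian.Ext.mk₀_smul]
  change r • e = 0
  rw [h1, h0]
  simp

/-- `Ext^i_R(k, M)` is a vector space over `k`: its `R`-action factors through `R → k`. -/
instance extResidueModule (M : Type u) [AddCommGroup M] [Module R M] (i : ℕ) :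
    Module (IsLocalRing.ResidueField R) (ExtResidue R M i) :=
  (extResidue_isTorsion R M i).module

instance extResidue_isScalarTower (M : Type u) [AddCommGroup M] [Module R M] (i : ℕ) :
    IsScalarTower R (IsLocalRing.ResidueField R) (ExtResidue R M i) :=
  (extResidue_isTorsion R M i).isScalarTower

/-- `dim_k Ext^i_R(k, M)`, as a cardinal. -/
def extDim (M : Type u) [AddCommGroup M] [Module R M] (i : ℕ) : Cardinal.{u} :=
  Module.rank (IsLocalRing.ResidueField R) (ExtResidue R M i)

/-- The depth of a local ring: the supremum of the lengths of the regular sequences contained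
in the maximal ideal. -/
def depth : ℕ∞ :=
  ⨆ (rs : List R) (_ : ∀ r ∈ rs, r ∈ IsLocalRing.maximalIdeal R)
    (_ : RingTheory.Sequence.IsRegular R rs), (rs.length : ℕ∞)

/-- A local ring is Cohen-Macaulay if it is Noetherian and its depth equals its Krull dimension. -/
structure IsCohenMacaulay : Prop where
  noetherian : IsNoetherianRing R
  depth_eq : ((depth R : ℕ∞) : WithBot ℕ∞) = ringKrullDim R

/-- Canonical modules of a (Cohen-Macaulay) local ring `R` with residue field `k`: finitely
generated modules `C` such that `dim_k Ext^i_R(k, C)` is `1` for `i = dim R` and `0` otherwise. -/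
structure IsCanonicalModule (C : Type u) [AddCommGroup C] [Module R C] : Prop where
  finite : Module.Finite R C
  extDim_eq_one : ∀ i : ℕ, (i : WithBot ℕ∞) = ringKrullDim R → extDim R C i = 1
  extDim_eq_zero : ∀ i : ℕ, (i : WithBot ℕ∞) ≠ ringKrullDim R → extDim R C i = 0

/-- The type `dim_k Ext^{dim R}_R(k, R)` of a (Cohen-Macaulay) local ring `R`; the Krull dimension
of a Noetherian local ring is a natural number. -/
def cmType : Cardinal.{u} :=
  extDim R R ((ringKrullDim R).unbotD 0).toNat

end LocalAlgebra

section Orders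

/-! ### Orders in étale algebras -/

variable {Z : Type u} (Q : Type v) {K : Type w} [CommRing Z] [Field Q] [CommRing K]
  [Algebra Z Q] [Algebra Q K] [Algebra Z K] [IsScalarTower Z Q K]

/-- A `Z`-order in `K`: a subring which is also a `Z`-lattice, that is, a finitely generated
`Z`-submodule spanning `K` over `Q`. -/
def IsOrder (S : Subalgebra Z K) : Prop :=
  Submodule.IsLattice Q (Subalgebra.toSubmodule S)

/-- A prime of the order `S`: a prime ideal of `S` which is also a `Z`-lattice in `K`. -/
structure IsPrimeOfOrder {S : Subalgebra Z K} (𝔭 : Ideal S) : Prop where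
  isPrime : 𝔭.IsPrime
  isLattice : Submodule.IsLattice Q ((𝔭.restrictScalars Z).map S.val.toLinearMap)

/-- The trace dual `S^t = {x ∈ K : Tr(xS) ⊆ Z}`, as an `S`-submodule of `K`. -/
def traceDual (S : Subalgebra Z K) : Submodule S K where
  carrier := {x | ∀ y ∈ S, Algebra.trace Q K (x * y) ∈ (algebraMap Z Q).range}
  zero_mem' := fun y _ => by simp
  add_mem' := fun {a b} ha hb y hy => by
    rw [add_mul, map_add]
    exact add_mem (ha y hy) (hb y hy)
  smul_mem' := fun s x hx y hy => by
    have h := hx ((s : K) * y) (mul_mem s.2 hy)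
    rwa [show (s • x) * y = x * ((s : K) * y) by rw [Subalgebra.smul_def, smul_eq_mul]; ring]

variable {S : Subalgebra Z K} (𝔭 : Ideal S)

/-- The completion of the ring `S` at `𝔭`, i.e. the inverse limit of the rings `S / 𝔭^n`. -/
abbrev completion : Type w := AdicCompletion 𝔭 S

/-- The completion of the trace dual `S^t` at `𝔭`: the base change of `S^t` to the completion
of `S` at `𝔭`. -/
abbrev completedTraceDual : Type w :=
  TensorProduct S (AdicCompletion 𝔭 S) (traceDual Q S)

end Orders

end OrderType

end

/-!
Write `A` for the completion of `S` at `𝔭`, `M` for `S` or `S^t`, and `k` for the common residue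
field of `S` at `𝔭` and `A`.

*The completion.* The prime `𝔭` contains a nonzero element `z` of `Z`. It is a nonzerodivisor on
`S`, and every prime of `S` containing it is maximal, as `S` is finite over `Z`. Hence `A / zA` is a
quotient of `S`, and the only prime of `A` containing `z` is `𝔭A`. That `A` is Noetherian is Cohen's
theorem: primes not containing `z` are finitely generated by successive approximation
(`fg_of_isPrime_of_notMem`). Since `A` is flat over `S`, `z` is also a nonzerodivisor on `A`,
so that `A` is Cohen-Macaulay, and the Hauptidealsatz shows that it has dimension one.

*Ext in degree zero and one.* As `z` is regular on `A ⊗ S^t` and kills `k`, there are no nonzero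
homomorphisms from `k` to `A ⊗ S^t`. As `A` is flat over `S`, the sequence `0 → A ⊗ 𝔭 → A → k → 0`
is exact, and `Ext¹_A(k, A ⊗ M)` is the cokernel of `A ⊗ M → Hom_A(A ⊗ 𝔭, A ⊗ M)`. This is the base
change of the cokernel of `M → Hom_S(𝔭, M)`, which is a vector space over `S / 𝔭 = k` and hence does
not change (`extDim_one_baseChange`).

*Ext in higher degrees.* The trace form of the étale algebra `K` is nondegenerate, so that the trace
identifies `S^t` with `Hom_Z(S, Z)`. Therefore `Hom_S(N, S^t) = Hom_Z(N, Z)` for every `S`-module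
`N`, and this functor is exact on modules that are projective over `Z`. Finitely generated
submodules of free `S`-modules are of this kind, and in particular so are `𝔭` and all its syzygies. After base
change to `A` this gives the vanishing of `Ext^i_A(A ⊗ 𝔭, A ⊗ S^t)` for `i ≥ 1`, and a
dimension shift gives that of `Ext^i_A(k, A ⊗ S^t)` for `i ≥ 2`.

*Duality.* Let `q = 𝔭 ∩ Z` and let `M × L → Z` be a perfect pairing which is balanced over `S`. Then
`Hom_S(𝔭, M) / M` is `Hom_Z(L / 𝔭L, Z / q)` (`exists_homQuotient_equiv_dual`). Indeed, the kernel of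
`𝔭 ⊗ L → 𝔭L` is torsion, so that `Hom_S(𝔭, M) = Hom_Z(𝔭 ⊗ L, Z) = Hom_Z(𝔭L, Z)`. A functional on
`𝔭L` extends uniquely to `L` with values in `q⁻¹`, and modulo the functionals in `M` it amounts to a
map from `L / 𝔭L` to `q⁻¹ / Z`. The isomorphism of `q⁻¹ / Z` with `Z / q` is made explicit as
multiplication by an `r ∈ q` for which some functional `α` on `q` has `α r ∉ q`. Counting dimensions
over `Z / q` gives `dim_k Hom_S(𝔭, M) / M = dim_k L / 𝔭L`. For the trace pairing `S^t × S → Z` this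
dimension is `dim_k S / 𝔭 = 1`, and for its transpose, which is perfect as `S` is reflexive over `Z`,
it is `dim_k S^t / 𝔭S^t`.
-/

noncomputable section

namespace OrderType

/-! ### The completion of a one-dimensional ring at a maximal ideal -/

section Approximation

variable {A : Type*} [CommRing A] {I : Ideal A} {x : A} {P : Ideal A}

/-- Cohen's approximation argument: in an `I`-adically complete ring with `x ∈ I`, generators of
a prime modulo `x` lift to generators of the prime, provided that `x` is not in the prime. -/
theorem fg_of_isPrime_of_notMem [IsAdicComplete I A] (hx : x ∈ I)
    [IsNoetherianRing (A ⧸ Ideal.span {x})] (hP : P.IsPrime) (hxP : x ∉ P) : P.FG := by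
  classical
  obtain ⟨t, htP, ht⟩ : ∃ t : Finset A, (t : Set A) ⊆ P ∧
      Ideal.map (Ideal.Quotient.mk (Ideal.span {x})) P =
        Ideal.map (Ideal.Quotient.mk (Ideal.span {x})) (Ideal.span t) := by
    have hfg : (Submodule.span (A ⧸ Ideal.span {x})
        ((Ideal.Quotient.mk (Ideal.span {x})) '' (P : Set A))).FG :=
      IsNoetherian.noetherian _
    obtain ⟨t, ht, h⟩ := Submodule.fg_span_iff_fg_span_finset_subset _ |>.1 hfg
    obtain ⟨t', ht', rfl⟩ := Finset.subset_set_image_iff.1 ht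
    refine ⟨t', ht', ?_⟩
    rw [Ideal.map_span]
    rw [Finset.coe_image] at h
    exact h
  have hstep : ∀ p : P, ∃ c : A → A, ∃ q : P, (p : A) = ∑ i ∈ t, c i * i + x * q := by
    intro p
    have h1 : (p : A) ∈ Ideal.span (t : Set A) ⊔ Ideal.span {x} := by
      have h2 := Ideal.mem_map_of_mem (Ideal.Quotient.mk (Ideal.span {x})) p.2
      rw [ht] at h2
      have h3 := Ideal.mem_comap.2 h2
      rwa [Ideal.comap_map_of_surjective' _ Ideal.Quotient.mk_surjective, Ideal.mk_ker] at h3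
    obtain ⟨y, hy, z, hz, hyz⟩ := Submodule.mem_sup.1 h1
    obtain ⟨q, rfl⟩ := Ideal.mem_span_singleton'.1 hz
    obtain ⟨c, -, hc⟩ := Submodule.mem_span_finset.1 hy
    have hyP : y ∈ P := (Ideal.span_le.2 htP) hy
    have hq : q * x ∈ P := by
      have h4 : q * x = p - y := by rw [← hyz]; ring
      rw [h4]
      exact P.sub_mem p.2 hyP
    refine ⟨c, ⟨q, (hP.mem_or_mem hq).resolve_right hxP⟩, ?_⟩
    rw [← hyz, ← hc]
    simp [mul_comm]
  choose c q hcq using hstep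
  refine ⟨t, le_antisymm (Ideal.span_le.2 htP) fun p hp => ?_⟩
  let r : ℕ → P := fun n => q^[n] ⟨p, hp⟩
  have hr : ∀ n, (r n : A) = ∑ i ∈ t, c (r n) i * i + x * r (n + 1) := by
    intro n
    simp only [r, Function.iterate_succ_apply']
    exact hcq _
  -- Iterating `p = ∑ c i * i + x * q` expresses `p` through the generators up to `x ^ n`, with
  -- coefficients given by the partial sums `s i n`, which converge `I`-adically.
  let s : A → ℕ → A := fun i n => ∑ m ∈ Finset.range n, x ^ m * c (r m) i
  have hs : ∀ n, p = ∑ i ∈ t, s i n * i + x ^ n * r n := by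
    intro n
    induction n with
    | zero => simp [s, r]
    | succ n ih =>
      rw [ih, hr n]
      simp only [s, Finset.sum_range_succ, add_mul, Finset.sum_add_distrib, mul_add,
        Finset.mul_sum]
      ring_nf
  have hxn : ∀ n (a : A), x ^ n * a ∈ (I ^ n • ⊤ : Submodule A A) := by
    intro n a
    simpa using Ideal.mul_mem_right a _ (Ideal.pow_mem_pow hx n)
  have hlim : ∀ i, ∃ l, ∀ n, s i n ≡ l [SMOD (I ^ n • ⊤ : Submodule A A)] := by
    intro i
    refine IsPrecomplete.prec inferInstance fun {m n} hmn => ?_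
    obtain ⟨k, rfl⟩ := Nat.exists_eq_add_of_le hmn
    rw [SModEq.comm, SModEq.sub_mem]
    simp only [s, Finset.sum_range_add, add_sub_cancel_left]
    refine Submodule.sum_mem _ fun j _ => ?_
    rw [pow_add, mul_assoc]
    exact hxn m _
  choose l hl using hlim
  have hpl : p = ∑ i ∈ t, l i * i := by
    rw [← sub_eq_zero]
    refine IsHausdorff.haus (I := I) inferInstance _ fun n => ?_
    rw [SModEq.zero]
    have h5 : p - ∑ i ∈ t, l i * i = ∑ i ∈ t, (s i n - l i) * i + x ^ n * r n := by
      conv_lhs => rw [hs n]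
      simp only [sub_mul, Finset.sum_sub_distrib]
      ring
    rw [h5]
    refine Submodule.add_mem _ (Submodule.sum_mem _ fun i _ => ?_) (hxn n _)
    have h6 := SModEq.sub_mem.1 (hl i n)
    rw [mul_comm]
    exact Submodule.smul_mem _ _ h6
  rw [hpl]
  exact Ideal.sum_mem _ fun i hi => Ideal.mul_mem_left _ _ (Ideal.subset_span hi)

end Approximation

section Completion

variable {S : Type w} [CommRing S] [IsNoetherianRing S] (𝔭 : Ideal S)

theorem isLocalRing_adicCompletion [𝔭.IsMaximal] : IsLocalRing (AdicCompletion 𝔭 S) := by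
  have hfg : 𝔭.FG := IsNoetherian.noetherian 𝔭
  have := AdicCompletion.isMaximal_map_of_le 𝔭 𝔭 le_rfl hfg
  have := AdicCompletion.isAdicComplete_self 𝔭 hfg
  exact isLocalRing_of_isAdicComplete_maximal (𝔭.map (algebraMap S (AdicCompletion 𝔭 S)))

theorem maximalIdeal_adicCompletion [𝔭.IsMaximal] [IsLocalRing (AdicCompletion 𝔭 S)] :
    IsLocalRing.maximalIdeal (AdicCompletion 𝔭 S) = 𝔭.map (algebraMap S (AdicCompletion 𝔭 S)) :=
  (IsLocalRing.eq_maximalIdeal (AdicCompletion.isMaximal_map_of_le 𝔭 𝔭 le_rfl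
    (IsNoetherian.noetherian 𝔭))).symm

theorem exists_sub_algebraMap_mem_pow (n : ℕ) (a : AdicCompletion 𝔭 S) :
    ∃ s : S, a - algebraMap S _ s ∈ (𝔭.map (algebraMap S (AdicCompletion 𝔭 S))) ^ n := by
  obtain ⟨s, hs⟩ := Submodule.Quotient.mk_surjective _ (AdicCompletion.eval 𝔭 S n a)
  refine ⟨s, ?_⟩
  have h1 : a - algebraMap S _ s ∈ (AdicCompletion.eval 𝔭 S n).ker := by
    rw [LinearMap.mem_ker, map_sub, ← hs, sub_eq_zero]
    rfl
  rw [← AdicCompletion.pow_smul_top_eq_ker_eval (IsNoetherian.noetherian 𝔭),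
    Ideal.smul_top_eq_map] at h1
  rwa [Ideal.map_pow] at h1

variable {𝔭} {x : S}

/-- A power of `𝔭` is contained in `(x)` after completion, as `S / (x)` is Artinian. -/
theorem exists_map_pow_le_span [𝔭.IsMaximal]
    (hmax : ∀ P : Ideal S, P.IsPrime → x ∈ P → P.IsMaximal) :
    ∃ n, (𝔭.map (algebraMap S (AdicCompletion 𝔭 S))) ^ n ≤
      Ideal.span {algebraMap S (AdicCompletion 𝔭 S) x} := by
  have hart : IsArtinianRing (S ⧸ Ideal.span {x}) := by
    rw [isArtinianRing_iff_isNoetherianRing_krullDimLE_zero]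
    refine ⟨inferInstance, Ring.KrullDimLE.mk₀ fun P hP => ?_⟩
    have h1 : (P.comap (Ideal.Quotient.mk (Ideal.span {x}))).IsMaximal := by
      refine hmax _ (Ideal.comap_isPrime _ _) ?_
      rw [Ideal.mem_comap, Ideal.Quotient.eq_zero_iff_mem.2 (Ideal.mem_span_singleton_self x)]
      exact P.zero_mem
    rw [← Ideal.map_comap_of_surjective _ Ideal.Quotient.mk_surjective P]
    refine Ideal.IsMaximal.map_of_surjective_of_ker_le Ideal.Quotient.mk_surjective ?_
    exact Ideal.comap_mono bot_le
  obtain ⟨n, hn⟩ := IsArtinian.monotone_stabilizes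
    (⟨fun n => OrderDual.toDual ((𝔭.map (Ideal.Quotient.mk (Ideal.span {x}))) ^ n),
      fun _ _ h => Ideal.pow_le_pow_right h⟩ : ℕ →o (Ideal (S ⧸ Ideal.span {x}))ᵒᵈ)
  have h2 : 𝔭 ^ n ≤ 𝔭 ^ (n + 1) ⊔ Ideal.span {x} := by
    have h3 : (𝔭.map (Ideal.Quotient.mk (Ideal.span {x}))) ^ n =
      (𝔭.map (Ideal.Quotient.mk (Ideal.span {x}))) ^ (n + 1) := hn (n + 1) n.le_succ
    rw [← Ideal.map_pow, ← Ideal.map_pow] at h3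
    have h4 := Ideal.le_comap_map (f := Ideal.Quotient.mk (Ideal.span {x})) (I := 𝔭 ^ n)
    rwa [h3, Ideal.comap_map_of_surjective' _ Ideal.Quotient.mk_surjective, Ideal.mk_ker] at h4
  have hfg : 𝔭.FG := IsNoetherian.noetherian 𝔭
  have := AdicCompletion.isAdicComplete_self 𝔭 hfg
  refine ⟨n, Submodule.le_of_le_smul_of_le_jacobson_bot
    (I := 𝔭.map (algebraMap S (AdicCompletion 𝔭 S))) ((hfg.map _).pow)
    (IsAdicComplete.le_jacobson_bot _) ?_⟩
  have h5 := Ideal.map_mono (f := algebraMap S (AdicCompletion 𝔭 S)) h2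
  rw [Ideal.map_sup, Ideal.map_pow, Ideal.map_pow, Ideal.map_span, Set.image_singleton] at h5
  rw [smul_eq_mul, ← pow_succ', sup_comm]
  exact h5

/-- A prime of the completion containing `x` is the maximal ideal. -/
theorem eq_map_of_isPrime_of_mem [𝔭.IsMaximal]
    (hmax : ∀ P : Ideal S, P.IsPrime → x ∈ P → P.IsMaximal)
    {P : Ideal (AdicCompletion 𝔭 S)} (hP : P.IsPrime) (hx : algebraMap S _ x ∈ P) :
    P = 𝔭.map (algebraMap S (AdicCompletion 𝔭 S)) := by
  obtain ⟨n, hn⟩ := exists_map_pow_le_span (𝔭 := 𝔭) hmax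
  have hm := AdicCompletion.isMaximal_map_of_le 𝔭 𝔭 le_rfl (IsNoetherian.noetherian 𝔭)
  refine (hm.eq_of_le hP.ne_top ?_).symm
  refine hP.le_of_pow_le (n := n) (hn.trans ?_)
  rwa [Ideal.span_singleton_le_iff_mem]

theorem isNoetherianRing_adicCompletion [𝔭.IsMaximal] (hx : x ∈ 𝔭)
    (hmax : ∀ P : Ideal S, P.IsPrime → x ∈ P → P.IsMaximal) :
    IsNoetherianRing (AdicCompletion 𝔭 S) := by
  have hfg : 𝔭.FG := IsNoetherian.noetherian 𝔭
  obtain ⟨n, hn⟩ := exists_map_pow_le_span (𝔭 := 𝔭) hmax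
  have hsurj : Function.Surjective ((Ideal.Quotient.mk
      (Ideal.span {algebraMap S (AdicCompletion 𝔭 S) x})).comp (algebraMap S _)) := by
    intro a
    obtain ⟨a, rfl⟩ := Ideal.Quotient.mk_surjective a
    obtain ⟨s, hs⟩ := exists_sub_algebraMap_mem_pow 𝔭 n a
    exact ⟨s, (Ideal.Quotient.eq.2 (hn hs)).symm⟩
  have := isNoetherianRing_of_surjective _ _ _ hsurj
  have := AdicCompletion.isAdicComplete_self 𝔭 hfg
  refine IsNoetherianRing.of_prime fun P hP => ?_
  by_cases h : algebraMap S _ x ∈ P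
  · rw [eq_map_of_isPrime_of_mem hmax hP h]
    exact hfg.map _
  · exact fg_of_isPrime_of_notMem (Ideal.mem_map_of_mem _ hx) hP h

theorem algebraMap_mem_nonZeroDivisors_adicCompletion (hreg : x ∈ nonZeroDivisors S) :
    algebraMap S (AdicCompletion 𝔭 S) x ∈ nonZeroDivisors (AdicCompletion 𝔭 S) := by
  have h1 : IsSMulRegular S x := by
    rw [isSMulRegular_iff_right_eq_zero_of_smul]
    intro a ha
    exact (mul_left_mem_nonZeroDivisors_eq_zero_iff hreg).1 ha
  have h2 : IsSMulRegular (AdicCompletion 𝔭 S) x := h1.of_flat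
  rw [mem_nonZeroDivisors_iff_right]
  intro a ha
  refine isSMulRegular_iff_right_eq_zero_of_smul.1 h2 a ?_
  rw [Algebra.smul_def, mul_comm]
  exact ha

theorem ringKrullDim_adicCompletion [𝔭.IsMaximal] (hx : x ∈ 𝔭) (hreg : x ∈ nonZeroDivisors S)
    (hmax : ∀ P : Ideal S, P.IsPrime → x ∈ P → P.IsMaximal) :
    ringKrullDim (AdicCompletion 𝔭 S) = 1 := by
  have := isLocalRing_adicCompletion 𝔭
  have := isNoetherianRing_adicCompletion hx hmax
  have hm := maximalIdeal_adicCompletion 𝔭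
  have hxm : algebraMap S (AdicCompletion 𝔭 S) x ∈
      IsLocalRing.maximalIdeal (AdicCompletion 𝔭 S) := by
    rw [hm]
    exact Ideal.mem_map_of_mem _ hx
  refine le_antisymm ?_ ?_
  · rw [← IsLocalRing.maximalIdeal_height_eq_ringKrullDim]
    have h1 := Ideal.height_le_one_of_isPrincipal_of_mem_minimalPrimes
      (Ideal.span {algebraMap S (AdicCompletion 𝔭 S) x})
      (IsLocalRing.maximalIdeal (AdicCompletion 𝔭 S)) ⟨⟨inferInstance, by
        rwa [Ideal.span_singleton_le_iff_mem]⟩, fun P hP _ => by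
        rw [hm, eq_map_of_isPrime_of_mem hmax hP.1
          (by simpa [Ideal.span_singleton_le_iff_mem] using hP.2)]⟩
    exact_mod_cast h1
  · have h2 := ringKrullDim_quotient_succ_le_of_nonZeroDivisor
      (algebraMap_mem_nonZeroDivisors_adicCompletion (𝔭 := 𝔭) hreg)
    have : Nontrivial (AdicCompletion 𝔭 S ⧸ Ideal.span {algebraMap S (AdicCompletion 𝔭 S) x}) := by
      refine Ideal.Quotient.nontrivial_iff.2 fun h => ?_
      rw [Ideal.span_singleton_eq_top] at h
      exact (IsLocalRing.mem_maximalIdeal _).1 hxm h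
    have h3 : (0 : WithBot ℕ∞) ≤ ringKrullDim
        (AdicCompletion 𝔭 S ⧸ Ideal.span {algebraMap S (AdicCompletion 𝔭 S) x}) :=
      ringKrullDim_nonneg_of_nontrivial
    calc (1 : WithBot ℕ∞) = 0 + 1 := by simp
      _ ≤ _ := by gcongr
      _ ≤ _ := h2

/-- A Noetherian local ring of Krull dimension one whose maximal ideal contains a nonzerodivisor is
Cohen-Macaulay. -/
theorem isCohenMacaulay_of_ringKrullDim_eq_one {R : Type*} [CommRing R] [IsLocalRing R]
    [IsNoetherianRing R] (hdim : ringKrullDim R = 1) {r : R}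
    (hr : r ∈ IsLocalRing.maximalIdeal R) (hreg : r ∈ nonZeroDivisors R) :
    IsCohenMacaulay R := by
  refine ⟨inferInstance, ?_⟩
  rw [hdim]
  suffices h : depth R = 1 by rw [h]; rfl
  refine le_antisymm ?_ ?_
  · refine iSup_le fun rs => iSup_le fun hrs => iSup_le fun hrs' => ?_
    have h1 := ringKrullDim_add_length_eq_ringKrullDim_of_isRegular rs hrs'
    have h2 : Nontrivial (R ⧸ Ideal.ofList rs) := by
      refine Ideal.Quotient.nontrivial_iff.2 fun h => ?_
      exact hrs'.top_ne_smul (by rw [h]; simp)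
    have h3 : (0 : WithBot ℕ∞) ≤ ringKrullDim (R ⧸ Ideal.ofList rs) :=
      ringKrullDim_nonneg_of_nontrivial
    rw [hdim] at h1
    have h4 : (rs.length : WithBot ℕ∞) ≤ 1 := by
      calc (rs.length : WithBot ℕ∞) = 0 + rs.length := by simp
        _ ≤ _ := by gcongr
        _ = 1 := h1
    exact_mod_cast h4
  · refine le_iSup_of_le [r] (le_iSup_of_le (by simpa using hr) (le_iSup_of_le ?_ (by simp)))
    refine (IsLocalRing.isRegular_iff_isWeaklyRegular_of_subset_maximalIdeal
      (by simpa using hr)).2 ?_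
    rw [RingTheory.Sequence.isWeaklyRegular_singleton_iff,
      isSMulRegular_iff_right_eq_zero_of_smul]
    intro a ha
    exact (mul_left_mem_nonZeroDivisors_eq_zero_iff hreg).1 ha

end Completion

/-! ### Vanishing of Ext of the base change of a dualizing module -/

section ExtGeneral

open Abelian

variable {A : Type w} [CommRing A]

theorem ext_subsingleton_succ_of_shortExact {T : ShortComplex (ModuleCat.{w} A)}
    (hT : T.ShortExact) [Projective T.X₂] {C : ModuleCat.{w} A} {n : ℕ}
    (h : Subsingleton (Ext T.X₁ C n)) : Subsingleton (Ext T.X₃ C (n + 1)) := by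
  refine subsingleton_of_forall_eq 0 fun x => ?_
  obtain ⟨y, rfl⟩ := precomp_extClass_surjective_of_projective_X₂ C hT n x
  rw [Subsingleton.elim y 0, map_zero]

theorem ext_one_subsingleton_of_shortExact {T : ShortComplex (ModuleCat.{w} A)}
    (hT : T.ShortExact) [Projective T.X₂] {C : ModuleCat.{w} A}
    (h : ∀ g : T.X₁ ⟶ C, ∃ g' : T.X₂ ⟶ C, T.f ≫ g' = g) : Subsingleton (Ext T.X₃ C 1) := by
  refine subsingleton_of_forall_eq 0 fun x => ?_
  obtain ⟨y, rfl⟩ := precomp_extClass_surjective_of_projective_X₂ C hT 0 x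
  obtain ⟨g, rfl⟩ := Ext.addEquiv₀.symm.surjective y
  obtain ⟨g', rfl⟩ := h g
  change hT.extClass.comp (Ext.mk₀ (T.f ≫ g')) (add_comm 1 0) = 0
  rw [← Ext.mk₀_comp_mk₀, hT.extClass_comp_assoc]

theorem extDim_congr [IsLocalRing A] {M M' : Type w} [AddCommGroup M] [Module A M]
    [AddCommGroup M'] [Module A M'] (e : M ≃ₗ[A] M') (i : ℕ) :
    extDim A M i = extDim A M' i := by
  let f : ExtResidue A M i →ₗ[A] ExtResidue A M' i :=
    (Ext.mk₀ (ModuleCat.ofHom e.toLinearMap)).postcompOfLinear A _ (add_zero i)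
  let g : ExtResidue A M' i →ₗ[A] ExtResidue A M i :=
    (Ext.mk₀ (ModuleCat.ofHom e.symm.toLinearMap)).postcompOfLinear A _ (add_zero i)
  have hfg : f ∘ₗ g = LinearMap.id := by
    ext x
    change (x.comp (Ext.mk₀ (ModuleCat.ofHom e.symm.toLinearMap)) (add_zero i)).comp
      (Ext.mk₀ (ModuleCat.ofHom e.toLinearMap)) (add_zero i) = x
    rw [Ext.comp_assoc_of_third_deg_zero, Ext.mk₀_comp_mk₀, ← ModuleCat.ofHom_comp]
    simp
  have hgf : g ∘ₗ f = LinearMap.id := by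
    ext x
    change (x.comp (Ext.mk₀ (ModuleCat.ofHom e.toLinearMap)) (add_zero i)).comp
      (Ext.mk₀ (ModuleCat.ofHom e.symm.toLinearMap)) (add_zero i) = x
    rw [Ext.comp_assoc_of_third_deg_zero, Ext.mk₀_comp_mk₀, ← ModuleCat.ofHom_comp]
    simp
  let E : ExtResidue A M i ≃ₗ[A] ExtResidue A M' i := LinearEquiv.ofLinearMap f g hfg hgf
  exact (E.extendScalarsOfSurjective (S := IsLocalRing.ResidueField A)
    IsLocalRing.residue_surjective).rank_eq

end ExtGeneral

section BaseChange

open TensorProduct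

variable {S A : Type w} [CommRing S] [CommRing A] [Algebra S A] [Module.Flat S A]

/-- Homomorphisms between base changes extend along `N' → N` as soon as those over the base do. -/
theorem exists_extension_baseChange {N' N M : Type*} [AddCommGroup N'] [Module S N']
    [AddCommGroup N] [Module S N] [AddCommGroup M] [Module S M] [Module.FinitePresentation S N']
    (i : N' →ₗ[S] N) (h : ∀ g : N' →ₗ[S] M, ∃ g' : N →ₗ[S] M, g' ∘ₗ i = g)
    (g : A ⊗[S] N' →ₗ[A] A ⊗[S] M) :
    ∃ g' : A ⊗[S] N →ₗ[A] A ⊗[S] M, g' ∘ₗ i.baseChange A = g := by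
  induction g using (Module.FinitePresentation.isBaseChange_map S N' M A).inductionOn with
  | zero => exact ⟨0, by simp⟩
  | tmul g =>
    obtain ⟨g', rfl⟩ := h g
    exact ⟨g'.baseChange A, by simp [LinearMap.baseChange_comp]⟩
  | smul a g hg =>
    obtain ⟨g', rfl⟩ := hg
    exact ⟨a • g', rfl⟩
  | add g₁ g₂ h₁ h₂ =>
    obtain ⟨g₁, rfl⟩ := h₁
    obtain ⟨g₂, rfl⟩ := h₂
    exact ⟨g₁ + g₂, rfl⟩

end BaseChange

section Vanishing

open TensorProduct Abelian

variable {Z : Type u} {S A : Type w} [CommRing Z] [CommRing S] [Algebra Z S] [CommRing A]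
  [Algebra S A]

theorem exists_retraction_ker {F N : Type*} [AddCommGroup F] [AddCommGroup N] [Module S F]
    [Module S N] [Module Z F] [Module Z N] [IsScalarTower Z S F] [IsScalarTower Z S N]
    [Module.Projective Z N] (f : F →ₗ[S] N) (hf : Function.Surjective f) :
    ∃ r : F →ₗ[Z] LinearMap.ker f, ∀ x : LinearMap.ker f, r x = x := by
  obtain ⟨s, hs⟩ := Module.projective_lifting_property (f.restrictScalars Z) LinearMap.id hf
  have hs' : ∀ y, f (s y) = y := fun y => LinearMap.congr_fun hs y
  refine ⟨⟨⟨fun x => ⟨x - s (f x), by simp [hs']⟩, fun x y => ?_⟩, fun z x => ?_⟩, fun x => ?_⟩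
  · ext
    simp only [map_add, Submodule.coe_add]
    abel
  · ext
    have h1 : f (z • x) = z • f x := (f.restrictScalars Z).map_smul z x
    simp only [h1, map_smul, RingHom.id_apply, SetLike.val_smul_of_tower, smul_sub]
  · ext
    simp [LinearMap.mem_ker.1 x.2]

/-- If evaluation along `t : M → Z` identifies `M` with `Hom_Z(S, Z)`, then homomorphisms to `M`
extend from the kernel of an `S`-linear surjection onto a `Z`-projective module: such
homomorphisms are the same as `Z`-linear ones to `Z`. -/
theorem exists_extension_of_dualizing {M : Type*} [AddCommGroup M] [Module S M] [Module Z M]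
    [IsScalarTower Z S M] (t : M →ₗ[Z] Z) (ht : ∀ φ : S →ₗ[Z] Z, ∃! m : M, ∀ s, t (s • m) = φ s)
    {F N : Type*} [AddCommGroup F] [AddCommGroup N] [Module S F]
    [Module S N] [Module Z F] [Module Z N] [IsScalarTower Z S F] [IsScalarTower Z S N]
    [Module.Projective Z N] (f : F →ₗ[S] N) (hf : Function.Surjective f)
    (g : LinearMap.ker f →ₗ[S] M) :
    ∃ g' : F →ₗ[S] M, g' ∘ₗ (LinearMap.ker f).subtype = g := by
  obtain ⟨r, hr⟩ := exists_retraction_ker (Z := Z) f hf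
  let h : F →ₗ[Z] Z := t ∘ₗ g.restrictScalars Z ∘ₗ r
  have huniq : ∀ m m' : M, (∀ s : S, t (s • m) = t (s • m')) → m = m' := by
    intro m m' hm
    let φ : S →ₗ[Z] Z := t ∘ₗ (LinearMap.toSpanSingleton S M m').restrictScalars Z
    exact (ht φ).unique (fun s => hm s) (fun s => rfl)
  choose G hG using fun x : F =>
    (ht (h ∘ₗ (LinearMap.toSpanSingleton S F x).restrictScalars Z)).exists
  have hG' : ∀ x s, t (s • G x) = h (s • x) := hG
  refine ⟨⟨⟨G, fun x y => ?_⟩, fun a x => ?_⟩, ?_⟩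
  · refine huniq _ _ fun s => ?_
    rw [smul_add, map_add, hG', hG', hG', smul_add, map_add]
  · refine huniq _ _ fun s => ?_
    simp only [RingHom.id_apply]
    rw [← mul_smul, hG', hG', mul_smul]
  · ext x
    refine huniq _ _ fun s => ?_
    change t (s • G x) = _
    rw [hG']
    change t (g (r (s • x : LinearMap.ker f))) = _
    rw [hr, map_smul]

variable [Module.Flat S A]

theorem baseChange_shortComplexKer_shortExact {F N : Type w} [AddCommGroup F] [AddCommGroup N]
    [Module S F] [Module S N] (f : F →ₗ[S] N) (hf : Function.Surjective f) :
    (ModuleCat.shortComplexOfCompEqZero ((LinearMap.ker f).subtype.baseChange A) (f.baseChange A)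
      (by rw [← LinearMap.baseChange_comp, LinearMap.comp_ker_subtype,
        LinearMap.baseChange_zero])).ShortExact := by
  refine ModuleCat.shortComplex_shortExact _ ?_ ?_ ?_
  · exact lTensor_exact A (LinearMap.exact_subtype_ker_map f) hf
  · exact Module.Flat.lTensor_preserves_injective_linearMap _ (Submodule.injective_subtype _)
  · exact LinearMap.lTensor_surjective A hf

/-- `Ext` of positive degree from the base change of a finitely generated `S`-module which is
projective over `Z` into the base change of a dualizing module vanishes. -/
theorem ext_baseChange_subsingleton [IsNoetherianRing S] [Module.Projective Z S] {M : Type w}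
    [AddCommGroup M] [Module S M] [Module Z M] [IsScalarTower Z S M] (t : M →ₗ[Z] Z)
    (ht : ∀ φ : S →ₗ[Z] Z, ∃! m : M, ∀ s, t (s • m) = φ s) (n : ℕ) :
    ∀ (N : Type w) [AddCommGroup N] [Module S N] [Module Z N] [IsScalarTower Z S N]
      [Module.Finite S N] [Module.Projective Z N],
      Subsingleton (Ext (ModuleCat.of A (A ⊗[S] N)) (ModuleCat.of A (A ⊗[S] M)) (n + 1)) := by
  induction n with
  | zero =>
    intro N _ _ _ _ _ _
    obtain ⟨r, f, hf⟩ := Module.Finite.exists_fin' S N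
    have := Module.finitePresentation_of_finite S (LinearMap.ker f)
    have hT := baseChange_shortComplexKer_shortExact (A := A) f hf
    have hproj : Projective (ModuleCat.of A (A ⊗[S] (Fin r → S))) := inferInstance
    refine ext_one_subsingleton_of_shortExact hT fun g => ?_
    obtain ⟨g', hg'⟩ := exists_extension_baseChange (A := A) (LinearMap.ker f).subtype
      (exists_extension_of_dualizing t ht f hf) g.hom
    exact ⟨ModuleCat.ofHom g', by ext1; exact hg'⟩
  | succ n ih =>
    intro N _ _ _ _ _ _
    obtain ⟨r, f, hf⟩ := Module.Finite.exists_fin' S N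
    have hT := baseChange_shortComplexKer_shortExact (A := A) f hf
    have hproj : Projective (ModuleCat.of A (A ⊗[S] (Fin r → S))) := inferInstance
    have : Module.Projective Z (Fin r → S) :=
      Module.Projective.of_equiv (DirectSum.linearEquivFunOnFintype Z (Fin r) fun _ => S)
    obtain ⟨ρ, hρ⟩ := exists_retraction_ker (Z := Z) f hf
    have : Module.Projective Z (LinearMap.ker f) :=
      Module.Projective.of_split ((LinearMap.ker f).subtype.restrictScalars Z) ρ
        (LinearMap.ext hρ)
    exact ext_subsingleton_succ_of_shortExact hT (ih (LinearMap.ker f))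

end Vanishing

/-! ### Ext of the residue field and flat base change -/

section HomQuotient

variable {S : Type w} [CommRing S] (𝔭 : Ideal S) (M : Type w) [AddCommGroup M] [Module S M]

/-- The map `M → Hom(𝔭, M)` sending `m` to multiplication by `m`. -/
def smulHom : M →ₗ[S] 𝔭 →ₗ[S] M :=
  LinearMap.lcomp S M 𝔭.subtype ∘ₗ (LinearMap.lsmul S M).flip

@[simp]
theorem smulHom_apply (m : M) (p : 𝔭) : smulHom 𝔭 M m p = (p : S) • m := rfl

/-- The cokernel of `M → Hom(𝔭, M)`, i.e. `Ext¹(S / 𝔭, M)`. -/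
abbrev HomQuotient : Type w := (𝔭 →ₗ[S] M) ⧸ LinearMap.range (smulHom 𝔭 M)

theorem homQuotient_isTorsion : Module.IsTorsionBySet S (HomQuotient 𝔭 M) (𝔭 : Set S) := by
  rintro x ⟨p, hp⟩
  obtain ⟨f, rfl⟩ := Submodule.Quotient.mk_surjective _ x
  change Submodule.Quotient.mk (p • f) = 0
  rw [Submodule.Quotient.mk_eq_zero]
  refine ⟨f ⟨p, hp⟩, ?_⟩
  ext p'
  rw [smulHom_apply, LinearMap.smul_apply, ← map_smul, ← map_smul]
  congr 1
  ext
  exact mul_comm _ _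

instance homQuotientModule : Module (S ⧸ 𝔭) (HomQuotient 𝔭 M) :=
  (homQuotient_isTorsion 𝔭 M).module

instance homQuotient_isScalarTower : IsScalarTower S (S ⧸ 𝔭) (HomQuotient 𝔭 M) :=
  (homQuotient_isTorsion 𝔭 M).isScalarTower

end HomQuotient

section ExtResidueBaseChange

open TensorProduct Abelian

variable {S A : Type w} [CommRing S] [CommRing A] [Algebra S A] {𝔭 : Ideal S}

variable (A 𝔭) in
/-- The multiplication map `A ⊗ 𝔭 → A`. -/
def tensorIdealHom : A ⊗[S] 𝔭 →ₗ[A] A :=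
  (AlgebraTensorModule.rid S A A).toLinearMap ∘ₗ 𝔭.subtype.baseChange A

@[simp]
theorem tensorIdealHom_tmul (a : A) (p : 𝔭) : tensorIdealHom A 𝔭 (a ⊗ₜ p) = (p : S) • a := by
  simp [tensorIdealHom]

theorem range_tensorIdealHom : LinearMap.range (tensorIdealHom A 𝔭) = 𝔭.map (algebraMap S A) := by
  refine le_antisymm ?_ ?_
  · rintro _ ⟨x, rfl⟩
    induction x with
    | zero => simp
    | add x y hx hy => rw [map_add]; exact add_mem hx hy
    | tmul a p =>
      rw [tensorIdealHom_tmul, Algebra.smul_def]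
      exact Ideal.mul_mem_right _ _ (Ideal.mem_map_of_mem _ p.2)
  · refine Ideal.map_le_iff_le_comap.2 fun p hp => ⟨1 ⊗ₜ ⟨p, hp⟩, ?_⟩
    rw [tensorIdealHom_tmul, Algebra.smul_def, mul_one]

theorem tensorIdealHom_injective [Module.Flat S A] : Function.Injective (tensorIdealHom A 𝔭) :=
  (AlgebraTensorModule.rid S A A).injective.comp
    (Module.Flat.lTensor_preserves_injective_linearMap _ 𝔭.injective_subtype)

variable [IsLocalRing A]

theorem exact_tensorIdealHom (hm : IsLocalRing.maximalIdeal A = 𝔭.map (algebraMap S A)) :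
    Function.Exact (tensorIdealHom A 𝔭) (Algebra.linearMap A (IsLocalRing.ResidueField A)) := by
  intro x
  rw [← LinearMap.coe_range, SetLike.mem_coe, range_tensorIdealHom, ← hm]
  exact IsLocalRing.residue_eq_zero_iff x

variable (A 𝔭) in
/-- The complex `A ⊗ 𝔭 → A → k` presenting the residue field `k` of `A`. -/
abbrev residueComplex (hm : IsLocalRing.maximalIdeal A = 𝔭.map (algebraMap S A)) :
    ShortComplex (ModuleCat.{w} A) :=
  ModuleCat.shortComplexOfCompEqZero (tensorIdealHom A 𝔭)
    (Algebra.linearMap A (IsLocalRing.ResidueField A))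
    (exact_tensorIdealHom hm).linearMap_comp_eq_zero

theorem residueComplex_shortExact [Module.Flat S A]
    (hm : IsLocalRing.maximalIdeal A = 𝔭.map (algebraMap S A)) :
    (residueComplex A 𝔭 hm).ShortExact :=
  ModuleCat.shortComplex_shortExact _ (exact_tensorIdealHom hm) tensorIdealHom_injective
    IsLocalRing.residue_surjective

theorem exists_sub_algebraMap_mem [𝔭.IsMaximal] (σ : A →ₐ[S] S ⧸ 𝔭) (a : A) :
    ∃ s : S, a - algebraMap S A s ∈ IsLocalRing.maximalIdeal A := by
  obtain ⟨s, hs⟩ := Ideal.Quotient.mk_surjective (σ a)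
  have : Nontrivial (S ⧸ 𝔭) := Ideal.Quotient.nontrivial_iff.2 (Ideal.IsMaximal.ne_top ‹_›)
  refine ⟨s, (IsLocalRing.mem_maximalIdeal _).2 fun hu => ?_⟩
  refine (hu.map σ).ne_zero ?_
  rw [map_sub, AlgHom.commutes, ← hs]
  exact sub_self _

variable [Module.Flat S A] (M : Type w) [AddCommGroup M] [Module S M]

/-- The connecting map `Hom_S(𝔭, M) → Ext¹_A(k, A ⊗ M)`, which sends a homomorphism to the
pushout of the extension `0 → A ⊗ 𝔭 → A → k → 0` along its base change. -/
def connectingHom (hm : IsLocalRing.maximalIdeal A = 𝔭.map (algebraMap S A)) :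
    (𝔭 →ₗ[S] M) →ₛₗ[algebraMap S A] ExtResidue A (A ⊗[S] M) 1 where
  toFun f := (residueComplex_shortExact hm).extClass.comp
    (Ext.mk₀ (ModuleCat.ofHom (f.baseChange A))) (add_zero 1)
  map_add' f g := by
    rw [LinearMap.baseChange_add, ModuleCat.ofHom_add, Ext.mk₀_add, Ext.comp_add]
  map_smul' s f := by
    have h : (s • f).baseChange A = algebraMap S A s • f.baseChange A := by
      rw [LinearMap.baseChange_smul, algebraMap_smul]
    have h' : ModuleCat.ofHom (algebraMap S A s • f.baseChange A) =
      algebraMap S A s • ModuleCat.ofHom (f.baseChange A) := rfl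
    rw [h, h', Ext.mk₀_smul, Ext.comp_smul]

theorem connectingHom_smulHom (hm : IsLocalRing.maximalIdeal A = 𝔭.map (algebraMap S A)) (m : M) :
    connectingHom M hm (smulHom 𝔭 M m) = 0 := by
  let h : A →ₗ[A] A ⊗[S] M := LinearMap.toSpanSingleton A _ (1 ⊗ₜ m)
  have h1 : (smulHom 𝔭 M m).baseChange A = h ∘ₗ tensorIdealHom A 𝔭 := by
    refine AlgebraTensorModule.ext fun a p => ?_
    rw [LinearMap.baseChange_tmul, smulHom_apply, LinearMap.comp_apply, tensorIdealHom_tmul,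
      LinearMap.toSpanSingleton_apply, smul_tmul', smul_eq_mul, mul_one, smul_tmul]
  change (residueComplex_shortExact hm).extClass.comp
    (Ext.mk₀ (ModuleCat.ofHom ((smulHom 𝔭 M m).baseChange A))) (add_zero 1) = 0
  rw [h1, ModuleCat.ofHom_comp, ← Ext.mk₀_comp_mk₀]
  exact (residueComplex_shortExact hm).extClass_comp_assoc _

/-- Every extension comes from an `A`-linear map `A ⊗ 𝔭 → A ⊗ M`, which is an `A`-combination
of base changes. -/
theorem connectingHom_surjective [IsNoetherianRing S] [𝔭.IsMaximal] (σ : A →ₐ[S] S ⧸ 𝔭)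
    (hm : IsLocalRing.maximalIdeal A = 𝔭.map (algebraMap S A)) :
    Function.Surjective (connectingHom M hm) := by
  have := Module.finitePresentation_of_finite S 𝔭
  intro e
  have : Projective (residueComplex A 𝔭 hm).X₂ :=
    inferInstanceAs (Projective (ModuleCat.of A A))
  obtain ⟨y, rfl⟩ := precomp_extClass_surjective_of_projective_X₂ _
    (residueComplex_shortExact hm) 0 e
  obtain ⟨g, rfl⟩ := Ext.addEquiv₀.symm.surjective y
  obtain ⟨g, rfl⟩ : ∃ g' : A ⊗[S] 𝔭 →ₗ[A] A ⊗[S] M, ModuleCat.ofHom g' = g := ⟨g.hom, rfl⟩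
  change ∃ f, connectingHom M hm f = (residueComplex_shortExact hm).extClass.comp
    (Ext.mk₀ (ModuleCat.ofHom g)) (add_comm 1 0)
  induction g using (Module.FinitePresentation.isBaseChange_map S 𝔭 M A).inductionOn with
  | zero => exact ⟨0, by rw [map_zero, ModuleCat.ofHom_zero, Ext.mk₀_zero, Ext.comp_zero]⟩
  | tmul f => exact ⟨f, rfl⟩
  | smul a g hg =>
    obtain ⟨f, hf⟩ := hg
    -- The maximal ideal kills `Ext(k, -)`, so that `a` may be replaced by an element of `S`.
    obtain ⟨s, hs⟩ := exists_sub_algebraMap_mem σ a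
    refine ⟨s • f, ?_⟩
    have h' : ModuleCat.ofHom (a • g) = a • ModuleCat.ofHom g := rfl
    rw [LinearMap.map_smulₛₗ, hf, h', Ext.mk₀_smul, Ext.comp_smul]
    have htors := extResidue_isTorsion A (A ⊗[S] M) 1
    have h : (a - algebraMap S A s) • connectingHom M hm f = 0 :=
      @htors (connectingHom M hm f) ⟨_, hs⟩
    rw [sub_smul, sub_eq_zero, hf] at h
    exact h.symm
  | add g₁ g₂ h₁ h₂ =>
    obtain ⟨f₁, h₁⟩ := h₁
    obtain ⟨f₂, h₂⟩ := h₂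
    exact ⟨f₁ + f₂, by rw [map_add, h₁, h₂, ModuleCat.ofHom_add, Ext.mk₀_add, Ext.comp_add]⟩

/-- If the image of `f` vanishes, its base change is multiplication by some `c ∈ A ⊗ M`, so that
`1 ⊗ f` vanishes in the base change of the cokernel `HomQuotient 𝔭 M`. The latter is a module over
`S / 𝔭`, and `σ` makes it a retract of its base change. -/
theorem mem_range_smulHom_of_connectingHom_eq_zero [IsNoetherianRing S] (σ : A →ₐ[S] S ⧸ 𝔭)
    (hm : IsLocalRing.maximalIdeal A = 𝔭.map (algebraMap S A)) (f : 𝔭 →ₗ[S] M)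
    (hf : connectingHom M hm f = 0) : f ∈ LinearMap.range (smulHom 𝔭 M) := by
  have := Module.finitePresentation_of_finite S 𝔭
  obtain ⟨x, hx⟩ := Ext.contravariant_sequence_exact₁ (residueComplex_shortExact hm) _
    (Ext.mk₀ (ModuleCat.ofHom (f.baseChange A))) (add_zero 1) hf
  obtain ⟨h, rfl⟩ := Ext.addEquiv₀.symm.surjective x
  have hx' : Ext.mk₀ ((residueComplex A 𝔭 hm).f ≫ h) =
      Ext.mk₀ (ModuleCat.ofHom (f.baseChange A)) := by
    rw [← hx, ← Ext.mk₀_comp_mk₀]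
    rfl
  have hx'' : h.hom ∘ₗ tensorIdealHom A 𝔭 = f.baseChange A :=
    congrArg ModuleCat.Hom.hom (Ext.addEquiv₀.symm.injective hx')
  let E := (Module.FinitePresentation.isBaseChange_map S 𝔭 M A).equiv
  have hE : ∀ (a : A) (f : 𝔭 →ₗ[S] M), E (a ⊗ₜ f) = a • f.baseChange A := fun a f =>
    (Module.FinitePresentation.isBaseChange_map S 𝔭 M A).equiv_tmul a f
  have hD : ∀ c : A ⊗[S] M, E ((smulHom 𝔭 M).baseChange A c) =
      LinearMap.toSpanSingleton A _ c ∘ₗ tensorIdealHom A 𝔭 := by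
    intro c
    induction c with
    | zero => simp
    | add c d hc hd => rw [map_add, map_add, hc, hd]; ext; simp
    | tmul a m =>
      rw [LinearMap.baseChange_tmul, hE]
      ext p
      simp [TensorProduct.smul_tmul']
  have h1 : (smulHom 𝔭 M).baseChange A (h.hom (1 : A)) = 1 ⊗ₜ f := by
    apply E.injective
    rw [hD, hE, one_smul, ← hx'']
    congr 1
    ext
    simp
  -- The retraction `a ⊗ v ↦ σ a • v`.
  let b : A ⊗[S] HomQuotient 𝔭 M →ₗ[S] HomQuotient 𝔭 M :=
    TensorProduct.lift (LinearMap.mk₂ S (fun a v => σ a • v)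
      (fun a b v => by rw [map_add, add_smul])
      (fun s a v => by rw [map_smul, smul_assoc])
      (fun a v w => by rw [smul_add])
      (fun s a v => by rw [smul_comm]))
  have h2 : ∀ c : A ⊗[S] M, (LinearMap.range (smulHom 𝔭 M)).mkQ.baseChange A
      ((smulHom 𝔭 M).baseChange A c) = 0 := by
    intro c
    rw [← LinearMap.comp_apply, ← LinearMap.baseChange_comp, LinearMap.range_mkQ_comp,
      LinearMap.baseChange_zero, LinearMap.zero_apply]
  have h3 : b (1 ⊗ₜ (LinearMap.range (smulHom 𝔭 M)).mkQ f) = 0 := by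
    rw [← LinearMap.baseChange_tmul, ← h1, h2, map_zero]
  have h4 : b (1 ⊗ₜ (LinearMap.range (smulHom 𝔭 M)).mkQ f) =
      (LinearMap.range (smulHom 𝔭 M)).mkQ f := by
    simp [b]
  rw [h4] at h3
  exact (Submodule.Quotient.mk_eq_zero _).1 h3

/-- `Ext¹` of the residue field commutes with flat base change along which the residue field does
not change. -/
theorem extDim_one_baseChange [IsNoetherianRing S] [𝔭.IsMaximal] (σ : A →ₐ[S] S ⧸ 𝔭)
    (hm : IsLocalRing.maximalIdeal A = 𝔭.map (algebraMap S A)) :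
    extDim A (A ⊗[S] M) 1 = Module.rank (S ⧸ 𝔭) (HomQuotient 𝔭 M) := by
  let := Ideal.Quotient.field 𝔭
  let i : S ⧸ 𝔭 →+* IsLocalRing.ResidueField A :=
    Ideal.Quotient.lift 𝔭 ((IsLocalRing.residue A).comp (algebraMap S A)) fun p hp =>
      (IsLocalRing.residue_eq_zero_iff _).2 (hm ▸ Ideal.mem_map_of_mem _ hp)
  have hi : Function.Bijective i := by
    refine ⟨i.injective, fun y => ?_⟩
    obtain ⟨a, rfl⟩ := IsLocalRing.residue_surjective y
    obtain ⟨s, hs⟩ := exists_sub_algebraMap_mem σ a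
    refine ⟨Ideal.Quotient.mk 𝔭 s, ?_⟩
    have h := (IsLocalRing.residue_eq_zero_iff _).2 hs
    rw [map_sub, sub_eq_zero] at h
    exact h.symm
  let j := (LinearMap.range (smulHom 𝔭 M)).liftQ (connectingHom (A := A) M hm) (by
    rintro _ ⟨m, rfl⟩
    exact connectingHom_smulHom M hm m)
  have hj : Function.Bijective j := by
    constructor
    · rw [injective_iff_map_eq_zero]
      intro x hx
      obtain ⟨f, rfl⟩ := Submodule.Quotient.mk_surjective _ x
      exact (Submodule.Quotient.mk_eq_zero _).2
        (mem_range_smulHom_of_connectingHom_eq_zero M σ hm f hx)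
    · intro e
      obtain ⟨f, rfl⟩ := connectingHom_surjective M σ hm e
      exact ⟨Submodule.Quotient.mk f, rfl⟩
  refine (rank_eq_of_equiv_equiv i (AddEquiv.ofBijective j hj) hi ?_).symm
  intro r v
  obtain ⟨s, rfl⟩ := Ideal.Quotient.mk_surjective r
  change j (s • v) = algebraMap A (IsLocalRing.ResidueField A) (algebraMap S A s) • j v
  rw [LinearMap.map_smulₛₗ]
  exact (algebraMap_smul (IsLocalRing.ResidueField A) (algebraMap S A s) (j v)).symm

/-- `Hom(k, A ⊗ M) = 0`, as `x` kills `k` and is regular on `A ⊗ M`. -/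
theorem extDim_zero_baseChange (hm : IsLocalRing.maximalIdeal A = 𝔭.map (algebraMap S A))
    {x : S} (hx : x ∈ 𝔭) (hreg : IsSMulRegular M x) : extDim A (A ⊗[S] M) 0 = 0 := by
  have h : Subsingleton (ExtResidue A (A ⊗[S] M) 0) := by
    refine subsingleton_of_forall_eq 0 fun e => ?_
    obtain ⟨g, rfl⟩ := Ext.addEquiv₀.symm.surjective e
    rw [map_eq_zero_iff _ (AddEquiv.injective _)]
    ext u
    have hreg' : IsSMulRegular (A ⊗[S] M) x :=
      hreg.lTensor A
    refine isSMulRegular_iff_right_eq_zero_of_smul.1 hreg' _ ?_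
    have h1 : algebraMap S A x ∈ IsLocalRing.maximalIdeal A := hm ▸ Ideal.mem_map_of_mem _ hx
    rw [← algebraMap_smul A, ← map_smul, Algebra.smul_def, IsLocalRing.ResidueField.algebraMap_eq,
      (IsLocalRing.residue_eq_zero_iff _).2 h1, zero_mul, map_zero]
  exact rank_subsingleton' _ _

/-- By a dimension shift along `0 → A ⊗ 𝔭 → A → k → 0`. -/
theorem extDim_succ_baseChange {Z : Type u} [CommRing Z] [Algebra Z S] [IsNoetherianRing S]
    [Module.Projective Z S] [Module.Projective Z 𝔭] [Module Z M] [IsScalarTower Z S M]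
    (hm : IsLocalRing.maximalIdeal A = 𝔭.map (algebraMap S A)) (t : M →ₗ[Z] Z)
    (ht : ∀ φ : S →ₗ[Z] Z, ∃! m : M, ∀ s, t (s • m) = φ s) (n : ℕ) :
    extDim A (A ⊗[S] M) (n + 2) = 0 := by
  have : Projective (residueComplex A 𝔭 hm).X₂ :=
    inferInstanceAs (Projective (ModuleCat.of A A))
  have h : Subsingleton (ExtResidue A (A ⊗[S] M) (n + 2)) :=
    ext_subsingleton_succ_of_shortExact (residueComplex_shortExact hm)
      (ext_baseChange_subsingleton t ht n 𝔭)
  exact rank_subsingleton' _ _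

end ExtResidueBaseChange

/-! ### Perfect pairings over a Dedekind domain -/

section Duality

/-- Since `q` is invertible, `q⁻¹ q ⊄ q`; the functional is multiplication by an element of
`q⁻¹`. -/
theorem exists_dual_apply_notMem {Z : Type*} [CommRing Z] [IsDedekindDomain Z] (q : Ideal Z)
    [hq : q.IsPrime] (h0 : q ≠ ⊥) : ∃ (α : q →ₗ[Z] Z) (r : q), α r ∉ q := by
  by_contra! hcon
  let Q := FractionRing Z
  have hne : (q : FractionalIdeal (nonZeroDivisors Z) Q) ≠ 0 := by
    simpa using h0
  have hmul := mul_inv_cancel₀ hne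
  have hle : (q : FractionalIdeal (nonZeroDivisors Z) Q) *
      (q : FractionalIdeal (nonZeroDivisors Z) Q)⁻¹ ≤
        (q : FractionalIdeal (nonZeroDivisors Z) Q) := by
    rw [FractionalIdeal.mul_le]
    intro x hx a ha
    obtain ⟨x, hxq, rfl⟩ := (FractionalIdeal.mem_coeIdeal _).1 hx
    rw [FractionalIdeal.mem_inv_iff hne] at ha
    have hz : ∀ z : q, ∃ z' : Z, algebraMap Z Q z' = a * algebraMap Z Q z := fun z =>
      (FractionalIdeal.mem_one_iff _).1 (ha _ (FractionalIdeal.mem_coeIdeal_of_mem _ z.2))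
    choose f hf using hz
    have hinj := IsFractionRing.injective Z Q
    let α : q →ₗ[Z] Z :=
      { toFun := f
        map_add' := fun y z => hinj (by simp [hf, mul_add])
        map_smul' := fun c z => hinj (by simp [hf]; ring) }
    rw [mul_comm, ← hf ⟨x, hxq⟩]
    exact FractionalIdeal.mem_coeIdeal_of_mem _ (hcon α ⟨x, hxq⟩)
  rw [hmul] at hle
  obtain ⟨y, hy, hy1⟩ := (FractionalIdeal.mem_coeIdeal _).1
    (hle ((FractionalIdeal.mem_one_iff _).2 ⟨1, map_one _⟩))
  have : y = 1 := IsFractionRing.injective Z Q (by rw [hy1, map_one])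
  exact hq.ne_top ((Ideal.eq_top_iff_one _).2 (this ▸ hy))

variable {Z : Type u} {S : Type w} [CommRing Z] [CommRing S] [Algebra Z S]

/-- The `Z`-linear map induced on the quotient by an `S`-submodule. -/
def liftQuotient {X Y : Type*} [AddCommGroup X] [Module S X] [Module Z X] [IsScalarTower Z S X]
    [AddCommGroup Y] [Module Z Y] (N : Submodule S X) (g : X →ₗ[Z] Y) (hg : ∀ x ∈ N, g x = 0) :
    (X ⧸ N) →ₗ[Z] Y :=
  (N.restrictScalars Z).liftQ g hg ∘ₗ (Submodule.Quotient.restrictScalarsEquiv Z N).symm.toLinearMap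

variable (𝔭 : Ideal S) {M L : Type w} [AddCommGroup M] [Module S M] [Module Z M]
  [IsScalarTower Z S M] [AddCommGroup L] [Module S L] [Module Z L]

variable {𝔭} in
/-- The embedding `q → 𝔭` for an ideal `q` of the base lying below `𝔭`. -/
def idealIncl {q : Ideal Z} (hq : q ≤ 𝔭.comap (algebraMap Z S)) (z : q) : 𝔭 :=
  ⟨algebraMap Z S z, hq z.2⟩

variable {𝔭} in
theorem smul_apply_idealIncl {q : Ideal Z} (hq : q ≤ 𝔭.comap (algebraMap Z S)) (f : 𝔭 →ₗ[S] M)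
    (p : 𝔭) (z : q) : (p : S) • f (idealIncl hq z) = (z : Z) • f p := by
  rw [← algebraMap_smul S (z : Z) (f p), ← map_smul, ← map_smul]
  congr 1
  ext
  exact mul_comm _ _

variable (τ : M →ₗ[Z] L →ₗ[Z] Z) (hτ : ∀ (s : S) (m : M) (l : L), τ (s • m) l = τ m (s • l))

section
include hτ

theorem mk_pairing_eq_zero {q : Ideal Z} (hq : q ≤ 𝔭.comap (algebraMap Z S)) (r : q)
    (f : 𝔭 →ₗ[S] M) (l : L) (hl : l ∈ (𝔭 • ⊤ : Submodule S L)) :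
    (Algebra.linearMap Z (Z ⧸ q) ∘ₗ τ (f (idealIncl hq r))) l = 0 := by
  induction hl using Submodule.smul_induction_on' with
  | smul p hp l _ =>
    have h := smul_apply_idealIncl hq f ⟨p, hp⟩ r
    change p • _ = _ at h
    rw [LinearMap.comp_apply, ← hτ, h, map_smul, LinearMap.smul_apply, smul_eq_mul]
    exact Ideal.Quotient.eq_zero_iff_mem.2 (q.mul_mem_right _ r.2)
  | add l _ l' _ h h' => rw [map_add, h, h', add_zero]

end

variable [IsScalarTower Z S L]

/-- The map `Hom(𝔭, M) → Hom(L / 𝔭 L, Z / q)` sending `f` to the reduction of the pairing with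
`f r`, for `r ∈ q`. -/
def homToDual {q : Ideal Z} (hq : q ≤ 𝔭.comap (algebraMap Z S)) (r : q) :
    (𝔭 →ₗ[S] M) →ₗ[Z] (L ⧸ (𝔭 • ⊤ : Submodule S L)) →ₗ[Z] Z ⧸ q where
  toFun f := liftQuotient (𝔭 • ⊤ : Submodule S L)
    (Algebra.linearMap Z (Z ⧸ q) ∘ₗ τ (f (idealIncl hq r))) (mk_pairing_eq_zero 𝔭 τ hτ hq r f)
  map_add' f g := LinearMap.ext fun l => by
    obtain ⟨l, rfl⟩ := Submodule.Quotient.mk_surjective _ l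
    change Ideal.Quotient.mk q (τ (f (idealIncl hq r) + g (idealIncl hq r)) l) =
      Ideal.Quotient.mk q (τ (f (idealIncl hq r)) l) +
        Ideal.Quotient.mk q (τ (g (idealIncl hq r)) l)
    rw [map_add, LinearMap.add_apply, map_add]
  map_smul' z f := LinearMap.ext fun l => by
    obtain ⟨l, rfl⟩ := Submodule.Quotient.mk_surjective _ l
    change Ideal.Quotient.mk q (τ (z • f (idealIncl hq r)) l) =
      z • Ideal.Quotient.mk q (τ (f (idealIncl hq r)) l)
    rw [map_smul, LinearMap.smul_apply, smul_eq_mul, map_mul]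
    rfl

theorem homToDual_apply_mk {q : Ideal Z} (hq : q ≤ 𝔭.comap (algebraMap Z S)) (r : q)
    (f : 𝔭 →ₗ[S] M) (l : L) : homToDual 𝔭 τ hτ hq r f (Submodule.Quotient.mk l) =
      Ideal.Quotient.mk q (τ (f (idealIncl hq r)) l) := rfl

theorem homToDual_smulHom {q : Ideal Z} (hq : q ≤ 𝔭.comap (algebraMap Z S)) (r : q)
    (f : 𝔭 →ₗ[S] M) (hf : f ∈ LinearMap.range (smulHom 𝔭 M)) : homToDual 𝔭 τ hτ hq r f = 0 := by
  obtain ⟨m, rfl⟩ := hf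
  refine LinearMap.ext fun l => ?_
  obtain ⟨l, rfl⟩ := Submodule.Quotient.mk_surjective _ l
  rw [homToDual_apply_mk, smulHom_apply, LinearMap.zero_apply]
  change Ideal.Quotient.mk q (τ (algebraMap Z S r • m) l) = 0
  rw [algebraMap_smul, map_smul, LinearMap.smul_apply, smul_eq_mul,
    Ideal.Quotient.eq_zero_iff_mem]
  exact q.mul_mem_right _ r.2

/-- If the pairing with `f r` takes values in `q`, its composition with `α` is the pairing with some
`m`, and `m` acts on `𝔭` as `α r • f`. As `α r` is invertible modulo `q`, and multiples of `f` by
elements of `q` are multiplications, `f` is a multiplication. -/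
theorem mem_range_smulHom_of_homToDual_eq_zero (hbij : Function.Bijective τ) {q : Ideal Z}
    [q.IsMaximal] (hq : q ≤ 𝔭.comap (algebraMap Z S)) (α : q →ₗ[Z] Z) (r : q) (hr : α r ∉ q)
    (f : 𝔭 →ₗ[S] M) (hf : homToDual 𝔭 τ hτ hq r f = 0) : f ∈ LinearMap.range (smulHom 𝔭 M) := by
  obtain ⟨w, e, he, hwe⟩ := Ideal.IsMaximal.exists_inv ‹q.IsMaximal› hr
  have hmem : ∀ l, τ (f (idealIncl hq r)) l ∈ q := fun l => by
    rw [← Ideal.Quotient.eq_zero_iff_mem, ← homToDual_apply_mk 𝔭 τ hτ hq, hf,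
      LinearMap.zero_apply]
  obtain ⟨m, hm⟩ := hbij.2 (α ∘ₗ LinearMap.codRestrict q (τ (f (idealIncl hq r))) hmem)
  have hm' : ∀ l, τ m l = α ⟨τ (f (idealIncl hq r)) l, hmem l⟩ := fun l => by rw [hm]; rfl
  have hm'' : ∀ p : 𝔭, (p : S) • m = α r • f p := by
    intro p
    refine hbij.1 (LinearMap.ext fun l => ?_)
    rw [hτ, hm', map_smul τ, LinearMap.smul_apply, smul_eq_mul]
    have h1 : (⟨τ (f (idealIncl hq r)) ((p : S) • l), hmem _⟩ : q) = τ (f p) l • r := by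
      ext
      change τ (f (idealIncl hq r)) ((p : S) • l) = τ (f p) l * r
      rw [← hτ, smul_apply_idealIncl, map_smul, LinearMap.smul_apply, smul_eq_mul, mul_comm]
    rw [h1, map_smul, smul_eq_mul, mul_comm]
  -- As `1 = w * α r + e`, `f` is multiplication by `w • m + f e`.
  refine ⟨f (idealIncl hq ⟨e, he⟩) + w • m, LinearMap.ext fun p => ?_⟩
  rw [smulHom_apply, smul_add, smul_apply_idealIncl, smul_comm, hm'', ← mul_smul, ← add_smul,
    add_comm, hwe, one_smul]

/-- Lift a functional on `L / 𝔭 L` to `lam : L → Z`, so that `lam (p • l) ∈ q` for `p ∈ 𝔭`. A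
preimage sends `p` to the element of `M` representing `l ↦ w * α (lam (p • l))`, where `w` is
inverse to `α r` modulo `q`. -/
theorem homToDual_surjective (hbij : Function.Bijective τ) [Module.Projective Z L] {q : Ideal Z}
    [q.IsMaximal] (hq : q ≤ 𝔭.comap (algebraMap Z S)) (α : q →ₗ[Z] Z) (r : q) (hr : α r ∉ q) :
    Function.Surjective (homToDual 𝔭 τ hτ hq r) := by
  obtain ⟨w, e, he, hwe⟩ := Ideal.IsMaximal.exists_inv ‹q.IsMaximal› hr
  intro χ
  obtain ⟨lam, hlam⟩ := Module.projective_lifting_property (Algebra.linearMap Z (Z ⧸ q))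
    (χ ∘ₗ (𝔭 • ⊤ : Submodule S L).mkQ.restrictScalars Z) Ideal.Quotient.mk_surjective
  have hlam' : ∀ l, Ideal.Quotient.mk q (lam l) = χ (Submodule.Quotient.mk l) :=
    fun l => LinearMap.congr_fun hlam l
  have hmem : ∀ (p : 𝔭) l, lam ((p : S) • l) ∈ q := fun p l => by
    rw [← Ideal.Quotient.eq_zero_iff_mem, hlam',
      (Submodule.Quotient.mk_eq_zero _).2 (Submodule.smul_mem_smul p.2 Submodule.mem_top),
      map_zero]
  choose F hF using fun p : 𝔭 => hbij.2 (w • α ∘ₗ LinearMap.codRestrict q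
    (lam ∘ₗ (LinearMap.lsmul S L (p : S)).restrictScalars Z) (hmem p))
  have hF' : ∀ p l, τ (F p) l = w * α ⟨lam ((p : S) • l), hmem p l⟩ := fun p l => by
    rw [hF]; rfl
  let f : 𝔭 →ₗ[S] M :=
    { toFun := F
      map_add' := fun p p' => hbij.1 (LinearMap.ext fun l => by
        rw [map_add, LinearMap.add_apply, hF', hF', hF', ← mul_add, ← map_add]
        congr 2
        ext
        change lam ((p + p' : S) • l) = lam ((p : S) • l) + lam ((p' : S) • l)
        rw [add_smul, map_add])
      map_smul' := fun s p => hbij.1 (LinearMap.ext fun l => by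
        rw [RingHom.id_apply, hτ, hF', hF']
        congr 2
        ext
        change lam ((s * p : S) • l) = lam ((p : S) • s • l)
        rw [mul_comm, mul_smul]) }
  refine ⟨f, LinearMap.ext fun l => ?_⟩
  obtain ⟨l, rfl⟩ := Submodule.Quotient.mk_surjective _ l
  rw [homToDual_apply_mk, ← hlam', Ideal.Quotient.mk_eq_mk_iff_sub_mem]
  change τ (F (idealIncl hq r)) l - lam l ∈ q
  have h1 : (⟨lam ((idealIncl hq r : S) • l), hmem _ _⟩ : q) = lam l • r := by
    ext
    change lam (algebraMap Z S r • l) = lam l * r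
    rw [algebraMap_smul, map_smul, smul_eq_mul, mul_comm]
  rw [hF', h1, map_smul, smul_eq_mul]
  have h2 : w * (lam l * α r) - lam l = -(e * lam l) := by
    linear_combination lam l * hwe
  rw [h2]
  exact q.neg_mem (q.mul_mem_right _ he)

include hτ in
/-- Over a maximal ideal `q ≠ 0` of the base below `𝔭`, a perfect `S`-balanced pairing of `M` and
`L` identifies the cokernel of `M → Hom(𝔭, M)` with the `Z / q`-dual of `L / 𝔭 L`. -/
theorem exists_homQuotient_equiv_dual (hbij : Function.Bijective τ) [Module.Projective Z L]
    [IsDedekindDomain Z] {q : Ideal Z} [q.IsMaximal] (h0 : q ≠ ⊥)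
    (hq : q ≤ 𝔭.comap (algebraMap Z S)) :
    Nonempty (HomQuotient 𝔭 M ≃ₗ[Z] ((L ⧸ (𝔭 • ⊤ : Submodule S L)) →ₗ[Z] Z ⧸ q)) := by
  obtain ⟨α, r, hr⟩ := exists_dual_apply_notMem q h0
  refine ⟨LinearEquiv.ofBijective (liftQuotient (LinearMap.range (smulHom 𝔭 M))
    (homToDual 𝔭 τ hτ hq r) (homToDual_smulHom 𝔭 τ hτ hq r)) ⟨?_, fun χ => ?_⟩⟩
  · rw [injective_iff_map_eq_zero]
    intro x hx
    obtain ⟨f, rfl⟩ := Submodule.Quotient.mk_surjective _ x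
    exact (Submodule.Quotient.mk_eq_zero _).2
      (mem_range_smulHom_of_homToDual_eq_zero 𝔭 τ hτ hbij hq α r hr f hx)
  · obtain ⟨f, hf⟩ := homToDual_surjective 𝔭 τ hτ hbij hq α r hr χ
    exact ⟨Submodule.Quotient.mk f, hf⟩

/-- A finite-dimensional `S / 𝔭`-vector space has the same dimension as any `S / 𝔭`-vector space
which is its dual over the subfield `Z / q`. -/
theorem rank_eq_of_equiv_dual [Module.Finite Z S] [𝔭.IsMaximal]
    {q : Ideal Z} [q.IsMaximal] (hq : q ≤ 𝔭.comap (algebraMap Z S)) {V W : Type w}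
    [AddCommGroup V] [AddCommGroup W] [Module Z V] [Module S V] [Module (S ⧸ 𝔭) V]
    [IsScalarTower Z S V] [IsScalarTower S (S ⧸ 𝔭) V]
    [Module Z W] [Module S W] [Module (S ⧸ 𝔭) W] [IsScalarTower Z S W] [IsScalarTower S (S ⧸ 𝔭) W]
    [Module.Finite (S ⧸ 𝔭) W] (e : V ≃ₗ[Z] (W →ₗ[Z] Z ⧸ q)) :
    Module.rank (S ⧸ 𝔭) V = Module.rank (S ⧸ 𝔭) W := by
  let : Field (Z ⧸ q) := Ideal.Quotient.field q
  let : Field (S ⧸ 𝔭) := Ideal.Quotient.field 𝔭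
  let i : Z ⧸ q →+* S ⧸ 𝔭 := Ideal.quotientMap 𝔭 (algebraMap Z S) hq
  let : Algebra (Z ⧸ q) (S ⧸ 𝔭) := i.toAlgebra
  let : Module (Z ⧸ q) V := Module.compHom V i
  let : Module (Z ⧸ q) W := Module.compHom W i
  have : IsScalarTower (Z ⧸ q) (S ⧸ 𝔭) V := ⟨fun a b v => mul_smul (i a) b v⟩
  have : IsScalarTower (Z ⧸ q) (S ⧸ 𝔭) W := ⟨fun a b v => mul_smul (i a) b v⟩
  have hV : IsScalarTower Z (Z ⧸ q) V := IsScalarTower.of_algebraMap_smul fun z v => by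
    rw [← algebraMap_smul S z v, ← algebraMap_smul (S ⧸ 𝔭) (algebraMap Z S z) v]
    rfl
  have hW : IsScalarTower Z (Z ⧸ q) W := IsScalarTower.of_algebraMap_smul fun z v => by
    rw [← algebraMap_smul S z v, ← algebraMap_smul (S ⧸ 𝔭) (algebraMap Z S z) v]
    rfl
  have : IsScalarTower Z (Z ⧸ q) (S ⧸ 𝔭) := IsScalarTower.of_algebraMap_eq fun z => rfl
  have : Module.Finite Z (S ⧸ 𝔭) := Module.Finite.trans S (S ⧸ 𝔭)
  have : Module.Finite (Z ⧸ q) (S ⧸ 𝔭) := Module.Finite.of_restrictScalars_finite Z _ _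
  have hsurj : Function.Surjective (algebraMap Z (Z ⧸ q)) := Ideal.Quotient.mk_surjective
  let e₁ : (W →ₗ[Z] Z ⧸ q) ≃ₗ[Z] Module.Dual (Z ⧸ q) W :=
    { toFun := fun f => f.extendScalarsOfSurjective hsurj
      invFun := fun f => f.restrictScalars Z
      map_add' := fun _ _ => rfl
      map_smul' := fun _ _ => rfl
      left_inv := fun _ => rfl
      right_inv := fun _ => rfl }
  let E : V ≃ₗ[Z ⧸ q] Module.Dual (Z ⧸ q) W := (e.trans e₁).extendScalarsOfSurjective hsurj
  have : Module.Finite (Z ⧸ q) W := Module.Finite.trans (S ⧸ 𝔭) W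
  have : Module.Finite (Z ⧸ q) V := Module.Finite.equiv E.symm
  have : Module.Finite (S ⧸ 𝔭) V := Module.Finite.of_restrictScalars_finite (Z ⧸ q) _ _
  have h1 : Module.finrank (Z ⧸ q) V = Module.finrank (Z ⧸ q) W := by
    rw [E.finrank_eq, Subspace.dual_finrank_eq]
  rw [← Module.finrank_mul_finrank (Z ⧸ q) (S ⧸ 𝔭) V,
    ← Module.finrank_mul_finrank (Z ⧸ q) (S ⧸ 𝔭) W] at h1
  rw [← Module.finrank_eq_rank, ← Module.finrank_eq_rank,
    Nat.eq_of_mul_eq_mul_left Module.finrank_pos h1]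

end Duality

/-! ### The trace pairing of an order -/

section TraceForm

open Algebra

theorem trace_pi_single {Q I : Type*} [Field Q] [Finite I] [DecidableEq I] {A : I → Type*}
    [∀ i, CommRing (A i)] [∀ i, Algebra Q (A i)] [∀ i, Module.Finite Q (A i)] (i : I) (a : A i) :
    trace Q (∀ i, A i) (Pi.single i a) = trace Q (A i) a := by
  have h1 : lmul Q (∀ i, A i) (Pi.single i a) =
      LinearMap.single Q A i ∘ₗ (lmul Q (A i) a ∘ₗ LinearMap.proj i) := by
    refine LinearMap.ext fun x => funext fun j => ?_
    by_cases h : j = i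
    · subst h
      simp
    · simp [h]
  have h2 : (lmul Q (A i) a ∘ₗ LinearMap.proj i) ∘ₗ LinearMap.single Q A i = lmul Q (A i) a :=
    LinearMap.ext fun x => by simp
  rw [trace_apply, trace_apply, h1, LinearMap.trace_comp_comm', h2]

/-- The trace form of an étale algebra over a field is nondegenerate, as the algebra is a product
of separable field extensions. -/
theorem eq_zero_of_trace_mul_eq_zero {Q K : Type*} [Field Q] [CommRing K] [Algebra Q K]
    [Algebra.Etale Q K] {x : K} (hx : ∀ y, trace Q K (x * y) = 0) : x = 0 := by
  classical
  obtain ⟨I, _, A, _, _, e, _⟩ := (FormallyEtale.iff_exists_algEquiv_prod Q K).1 inferInstance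
  have := FormallyUnramified.finite_of_free Q K
  have : ∀ i, Module.Finite Q (A i) := fun i =>
    Module.Finite.of_surjective (LinearMap.proj i ∘ₗ e.toLinearMap)
      ((Function.surjective_eval i).comp e.surjective)
  rw [← map_eq_zero_iff e e.injective]
  funext i
  refine (traceForm_nondegenerate Q (A i)).1 _ fun b => ?_
  rw [traceForm_apply, ← trace_pi_single, ← hx (e.symm (Pi.single i b)), ← trace_eq_of_algEquiv e,
    map_mul, AlgEquiv.apply_symm_apply]
  congr 1
  funext j
  by_cases h : j = i
  · subst h
    simp
  · simp [h]

theorem existsUnique_trace_mul_eq {Q K : Type*} [Field Q] [CommRing K] [Algebra Q K]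
    [Algebra.Etale Q K] (g : K →ₗ[Q] Q) : ∃! x, ∀ y, trace Q K (x * y) = g y := by
  have := FormallyUnramified.finite_of_free Q K
  have hinj : Function.Injective (traceForm Q K) :=
    (injective_iff_map_eq_zero _).2 fun x hx =>
      eq_zero_of_trace_mul_eq_zero fun y => LinearMap.congr_fun hx y
  have hsurj : Function.Surjective (traceForm Q K) :=
    (LinearMap.injective_iff_surjective_of_finrank_eq_finrank
      Subspace.dual_finrank_eq.symm).1 hinj
  obtain ⟨x, rfl⟩ := hsurj g
  exact ⟨x, fun _ => rfl, fun x' h => hinj (LinearMap.ext h)⟩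

end TraceForm

section Order

theorem isTorsionFree_of_isFractionRing (Z Q K : Type*) [CommRing Z] [IsDomain Z] [Field Q]
    [Algebra Z Q] [IsFractionRing Z Q] [CommRing K] [Algebra Q K] [Algebra Z K]
    [IsScalarTower Z Q K] : Module.IsTorsionFree Z K :=
  Module.IsTorsionFree.comap (algebraMap Z Q)
    (fun _ hz => IsRegular.of_ne_zero (IsFractionRing.to_map_ne_zero_of_mem_nonZeroDivisors
      (mem_nonZeroDivisors_of_ne_zero hz.ne_zero))) (fun z x => algebraMap_smul Q z x)

variable {Z : Type u} {Q : Type v} {K : Type w} [CommRing Z] [Field Q] [Algebra Z Q]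
  [CommRing K] [Algebra Q K] [Algebra Z K]

variable (Q) in
theorem exists_algebraMap_eq_trace (S : Subalgebra Z K) (x : traceDual Q S) :
    ∃ z : Z, algebraMap Z Q z = Algebra.trace Q K x := by
  obtain ⟨z, hz⟩ := x.2 1 S.one_mem
  exact ⟨z, by rw [hz, mul_one]⟩

variable [IsScalarTower Z Q K]

variable (Q) in
theorem exists_smul_mem_of_mem_span [IsFractionRing Z Q] [IsDomain Z] (N : Submodule Z K) {x : K}
    (hx : x ∈ Submodule.span Q (N : Set K)) : ∃ z : nonZeroDivisors Z, (z : Z) • x ∈ N := by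
  induction hx using Submodule.span_induction with
  | mem x h => exact ⟨1, by simpa using h⟩
  | zero => exact ⟨1, by simp⟩
  | add x y _ _ hx hy =>
    obtain ⟨z, hz⟩ := hx
    obtain ⟨z', hz'⟩ := hy
    refine ⟨z * z', ?_⟩
    rw [Submonoid.coe_mul, smul_add]
    refine N.add_mem ?_ (by rw [mul_smul]; exact N.smul_mem _ hz')
    rw [mul_comm, mul_smul]
    exact N.smul_mem _ hz
  | smul c x _ hx =>
    obtain ⟨z, hz⟩ := hx
    obtain ⟨⟨a, b⟩, hab⟩ := IsLocalization.surj (nonZeroDivisors Z) c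
    refine ⟨b * z, ?_⟩
    have h : ((b * z : nonZeroDivisors Z) : Z) • c • x = a • (z : Z) • x := by
      rw [← algebraMap_smul Q ((b * z : nonZeroDivisors Z) : Z), ← algebraMap_smul Q a,
        ← algebraMap_smul Q (z : Z) x, ← mul_smul, ← mul_smul, ← hab, Submonoid.coe_mul, map_mul]
      congr 1
      ring
    rw [h]
    exact N.smul_mem _ hz

variable [IsFractionRing Z Q]

/-- The localization of a lattice `N` in `K` at the nonzero elements of `Z` is `K`. -/
theorem isLocalizedModule_of_span_eq_top [IsDomain Z] (N : Submodule Z K)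
    (hN : Submodule.span Q (N : Set K) = ⊤) : IsLocalizedModule (nonZeroDivisors Z) N.subtype where
  map_units z := by
    rw [Module.End.isUnit_iff]
    have hz : algebraMap Z Q z ≠ 0 := IsFractionRing.to_map_ne_zero_of_mem_nonZeroDivisors z.2
    have h : ∀ x : K, algebraMap Z (Module.End Z K) z x = algebraMap Z Q z • x := fun x =>
      (algebraMap_smul Q (z : Z) x).symm
    refine ⟨fun x y hxy => ?_, fun x => ⟨(algebraMap Z Q z)⁻¹ • x, ?_⟩⟩
    · rw [h, h] at hxy
      exact smul_right_injective K hz hxy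
    · rw [h, smul_inv_smul₀ hz]
  surj x := by
    obtain ⟨z, hz⟩ := exists_smul_mem_of_mem_span Q N (x := x) (hN ▸ Submodule.mem_top)
    exact ⟨(⟨_, hz⟩, z), rfl⟩
  exists_of_eq h := ⟨1, by rw [Subtype.ext h]⟩

/-- A `Z`-linear functional on a lattice is the trace pairing with a unique element of `K`. -/
theorem existsUnique_trace_mul_eq_of_lattice [IsDomain Z] [Algebra.Etale Q K] (N : Submodule Z K)
    (hN : Submodule.span Q (N : Set K) = ⊤) (g : N →ₗ[Z] Q) :
    ∃! x : K, ∀ n : N, Algebra.trace Q K (x * n) = g n := by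
  have := isLocalizedModule_of_span_eq_top N hN
  have hunit : ∀ z : nonZeroDivisors Z, IsUnit (algebraMap Z (Module.End Z Q) z) := by
    intro z
    exact IsLocalizedModule.map_units (Algebra.linearMap Z Q) z
  let G : K →ₗ[Q] Q := LinearMap.extendScalarsOfIsLocalization (nonZeroDivisors Z) Q
    (IsLocalizedModule.lift (nonZeroDivisors Z) N.subtype g hunit)
  have hG : ∀ n : N, G n = g n := fun n =>
    IsLocalizedModule.lift_apply (nonZeroDivisors Z) N.subtype g hunit n
  obtain ⟨x, hx, -⟩ := existsUnique_trace_mul_eq G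
  refine ⟨x, fun n => by rw [hx, hG], fun x' hx' => ?_⟩
  rw [← sub_eq_zero]
  refine eq_zero_of_trace_mul_eq_zero (Q := Q) fun y => ?_
  have hy : y ∈ Submodule.span Q (N : Set K) := hN ▸ Submodule.mem_top
  induction hy using Submodule.span_induction with
  | mem y h =>
    rw [sub_mul, map_sub, sub_eq_zero]
    exact (hx' ⟨y, h⟩).trans ((hx y).trans (hG ⟨y, h⟩)).symm
  | zero => simp
  | add y y' _ _ h h' => rw [mul_add, map_add, h, h', add_zero]
  | smul c y _ h => rw [mul_smul_comm, map_smul, h, smul_zero]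

variable (Q) (S : Subalgebra Z K)

/-- The trace `S^t → Z`. -/
def traceDualTrace : traceDual Q S →ₗ[Z] Z where
  toFun x := (exists_algebraMap_eq_trace Q S x).choose
  map_add' x y := IsFractionRing.injective Z Q <| by
    rw [map_add, (exists_algebraMap_eq_trace Q S x).choose_spec,
      (exists_algebraMap_eq_trace Q S y).choose_spec,
      (exists_algebraMap_eq_trace Q S (x + y)).choose_spec, Submodule.coe_add, map_add]
  map_smul' z x := IsFractionRing.injective Z Q <| by
    rw [RingHom.id_apply, smul_eq_mul, map_mul, (exists_algebraMap_eq_trace Q S x).choose_spec,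
      (exists_algebraMap_eq_trace Q S (z • x)).choose_spec, ← smul_eq_mul, ← map_smul,
      algebraMap_smul]
    rfl

theorem algebraMap_traceDualTrace (x : traceDual Q S) :
    algebraMap Z Q (traceDualTrace Q S x) = Algebra.trace Q K x :=
  (exists_algebraMap_eq_trace Q S x).choose_spec

/-- The trace dual represents `Hom_Z(S, Z)` via the trace. -/
theorem existsUnique_traceDualTrace_smul [IsDomain Z] [Algebra.Etale Q K] (hS : IsOrder Q S)
    (φ : S →ₗ[Z] Z) :
    ∃! x : traceDual Q S, ∀ s : S, traceDualTrace Q S (s • x) = φ s := by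
  have hinj := IsFractionRing.injective Z Q
  have hval : ∀ (s : S) (x : traceDual Q S),
      algebraMap Z Q (traceDualTrace Q S (s • x)) = Algebra.trace Q K (x * s) := fun s x => by
    rw [algebraMap_traceDualTrace, mul_comm]
    rfl
  obtain ⟨x, hx, huniq⟩ := existsUnique_trace_mul_eq_of_lattice (Q := Q)
    (Subalgebra.toSubmodule S) hS.span_eq_top (Algebra.linearMap Z Q ∘ₗ φ)
  have hx' : ∀ s : S, Algebra.trace Q K (x * s) = algebraMap Z Q (φ s) := fun s => hx s
  refine ⟨⟨x, fun s hs => ⟨φ ⟨s, hs⟩, (hx' ⟨s, hs⟩).symm⟩⟩, fun s => hinj ?_, fun y hy => ?_⟩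
  · rw [hval, hx']
  · exact Subtype.ext (huniq y fun s => by
      have h := congrArg (algebraMap Z Q) (hy s)
      rwa [hval] at h)

/-- The trace pairing `S^t × S → Z`. -/
def tracePairing : traceDual Q S →ₗ[Z] S →ₗ[Z] Z where
  toFun x := traceDualTrace Q S ∘ₗ
    (LinearMap.toSpanSingleton S (traceDual Q S) x).restrictScalars Z
  map_add' x y := LinearMap.ext fun s => by
    change traceDualTrace Q S (s • (x + y)) = traceDualTrace Q S (s • x) +
      traceDualTrace Q S (s • y)
    rw [smul_add, map_add]
  map_smul' z x := LinearMap.ext fun s => by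
    change traceDualTrace Q S (s • z • x) = z • traceDualTrace Q S (s • x)
    rw [smul_comm, map_smul]

theorem tracePairing_apply (x : traceDual Q S) (s : S) :
    tracePairing Q S x s = traceDualTrace Q S (s • x) := rfl

theorem tracePairing_smul (s : S) (x : traceDual Q S) (s' : S) :
    tracePairing Q S (s • x) s' = tracePairing Q S x (s • s') := by
  rw [tracePairing_apply, tracePairing_apply, smul_eq_mul, mul_comm, mul_smul]

theorem tracePairing_bijective [IsDomain Z] [Algebra.Etale Q K] (hS : IsOrder Q S) :
    Function.Bijective (tracePairing Q S) :=
  ⟨fun _ y h => (existsUnique_traceDualTrace_smul Q S hS (tracePairing Q S y)).unique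
      (fun s => LinearMap.congr_fun h s) (fun _ => rfl),
    fun φ => (existsUnique_traceDualTrace_smul Q S hS φ).exists.imp fun _ h => LinearMap.ext h⟩

/-- The transpose is perfect as well, by the reflexivity of finite projective modules. -/
theorem tracePairing_flip_bijective [IsDomain Z] [Algebra.Etale Q K] (hS : IsOrder Q S)
    [Module.Finite Z S] [Module.Projective Z S] :
    Function.Bijective (tracePairing Q S).flip :=
  (LinearEquiv.ofBijective _ (tracePairing_bijective Q S hS)).dualMap.bijective.comp
    (Module.bijective_dual_eval Z S)

variable {Q S}

theorem exists_mem_of_isPrimeOfOrder [IsDomain Z] {𝔭 : Ideal S} (h𝔭 : IsPrimeOfOrder Q 𝔭) :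
    ∃ z : Z, z ≠ 0 ∧ algebraMap Z S z ∈ 𝔭 := by
  obtain ⟨z, hz⟩ := exists_smul_mem_of_mem_span Q _ (x := (1 : K))
    (h𝔭.isLattice.span_eq_top ▸ Submodule.mem_top)
  obtain ⟨p, hp, hpz⟩ := hz
  refine ⟨z, nonZeroDivisors.coe_ne_zero z, ?_⟩
  have : algebraMap Z S z = p := by
    ext
    change (algebraMap Z K z : K) = S.val p
    rw [Algebra.algebraMap_eq_smul_one]
    exact hpz.symm
  rw [this]
  exact hp

end Order

/-! ### Finiteness of orders and the dimension of Ext¹ -/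

theorem rank_eq_one_of_equiv_quotient {S : Type w} [CommRing S] (𝔭 : Ideal S) [𝔭.IsMaximal]
    {V : Type w} [AddCommGroup V] [Module S V] [Module (S ⧸ 𝔭) V] [IsScalarTower S (S ⧸ 𝔭) V]
    (e : V ≃ₗ[S] S ⧸ 𝔭) : Module.rank (S ⧸ 𝔭) V = 1 := by
  let := Ideal.Quotient.field 𝔭
  let E : V ≃ₗ[S ⧸ 𝔭] S ⧸ 𝔭 := e.extendScalarsOfSurjective Ideal.Quotient.mk_surjective
  rw [E.rank_eq, Module.rank_self]

section OrderFacts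

theorem projective_of_isTorsionFree {Z : Type*} [CommRing Z] [IsDedekindDomain Z]
    (N : Type*) [AddCommGroup N] [Module Z N] [Module.IsTorsionFree Z N]
    [Module.Finite Z N] : Module.Projective Z N :=
  have := Module.finitePresentation_of_finite Z N
  Module.Flat.projective_of_finitePresentation

variable {Z : Type u} {Q : Type v} {K : Type w} [CommRing Z] [Field Q] [Algebra Z Q]
  [CommRing K] [Algebra Q K] [Algebra Z K] [IsScalarTower Z Q K] {S : Subalgebra Z K}

theorem IsOrder.finite (hS : IsOrder Q S) : Module.Finite Z S :=
  Module.Finite.iff_fg.2 hS.fg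

variable [IsDedekindDomain Z]

theorem IsOrder.isNoetherianRing (hS : IsOrder Q S) : IsNoetherianRing S :=
  have := hS.finite
  IsNoetherianRing.of_finite Z S

/-- A prime of an order containing a nonzero element of the base is maximal. -/
theorem IsOrder.isMaximal_of_mem (hS : IsOrder Q S) {z : Z} (hz : z ≠ 0) {P : Ideal S}
    (hP : P.IsPrime) (hzP : algebraMap Z S z ∈ P) : P.IsMaximal := by
  have := hS.finite
  refine Ideal.isMaximal_of_isIntegral_of_isMaximal_comap (R := Z) P
    (Ideal.IsPrime.isMaximal inferInstance fun h => hz ?_)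
  rw [← Ideal.mem_bot, ← h]
  exact hzP

variable [IsFractionRing Z Q]

theorem IsOrder.projective (hS : IsOrder Q S) : Module.Projective Z S :=
  have := hS.finite
  have := isTorsionFree_of_isFractionRing Z Q K
  have : Module.IsTorsionFree Z S :=
    Function.Injective.moduleIsTorsionFree (N := K) _ Subtype.val_injective fun _ _ => rfl
  projective_of_isTorsionFree S

theorem IsOrder.projective_ideal (hS : IsOrder Q S) (I : Ideal S) : Module.Projective Z I := by
  have := hS.finite
  have := hS.isNoetherianRing
  have := isTorsionFree_of_isFractionRing Z Q K
  have : Module.IsTorsionFree Z I :=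
    Function.Injective.moduleIsTorsionFree (N := K) (fun x : I => ((x : S) : K))
      (Subtype.val_injective.comp Subtype.val_injective) fun _ _ => rfl
  have : Module.Finite Z I := Module.Finite.trans S I
  exact projective_of_isTorsionFree I

variable [Algebra.Etale Q K]

theorem IsOrder.finite_traceDual (hS : IsOrder Q S) : Module.Finite Z (traceDual Q S) :=
  have := hS.finite
  have := hS.projective
  Module.Finite.equiv (LinearEquiv.ofBijective _ (tracePairing_bijective Q S hS)).symm

theorem IsOrder.rank_homQuotient_traceDual (hS : IsOrder Q S) (𝔭 : Ideal S) [𝔭.IsMaximal]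
    {q : Ideal Z} [q.IsMaximal] (h0 : q ≠ ⊥) (hq : q ≤ 𝔭.comap (algebraMap Z S)) :
    Module.rank (S ⧸ 𝔭) (HomQuotient 𝔭 (traceDual Q S)) = 1 := by
  have := hS.finite
  have := hS.projective
  obtain ⟨e⟩ := exists_homQuotient_equiv_dual 𝔭 (tracePairing Q S) (tracePairing_smul Q S)
    (tracePairing_bijective Q S hS) h0 hq
  rw [rank_eq_of_equiv_dual 𝔭 hq e]
  exact rank_eq_one_of_equiv_quotient 𝔭 (Submodule.quotEquivOfEq _ _ (Ideal.mul_top 𝔭))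

theorem IsOrder.rank_homQuotient_self (hS : IsOrder Q S) (𝔭 : Ideal S) [𝔭.IsMaximal]
    {q : Ideal Z} [q.IsMaximal] (h0 : q ≠ ⊥) (hq : q ≤ 𝔭.comap (algebraMap Z S)) :
    Module.rank (S ⧸ 𝔭) (HomQuotient 𝔭 S) =
      Module.rank (S ⧸ 𝔭) (traceDual Q S ⧸ (𝔭 • ⊤ : Submodule S (traceDual Q S))) := by
  have := hS.finite
  have := hS.projective
  have := hS.finite_traceDual
  have : Module.Projective Z (traceDual Q S) := Module.Projective.of_equiv
    (LinearEquiv.ofBijective _ (tracePairing_bijective Q S hS)).symm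
  have : Module.Finite S (traceDual Q S) := Module.Finite.of_restrictScalars_finite Z _ _
  obtain ⟨e⟩ := exists_homQuotient_equiv_dual 𝔭 (tracePairing Q S).flip
    (fun s s' x => (tracePairing_smul Q S s x s').symm) (tracePairing_flip_bijective Q S hS) h0 hq
  exact rank_eq_of_equiv_dual 𝔭 hq e

end OrderFacts

end OrderType

end

theorem proposition3p1 {Z : Type u} {Q : Type v} {K : Type w}
    [CommRing Z] [IsDedekindDomain Z] (hZ : ¬ IsField Z)
    [Field Q] [Algebra Z Q] [IsFractionRing Z Q]
    [CommRing K] [Nontrivial K] [Algebra Q K] [Algebra.Etale Q K]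
    [Algebra Z K] [IsScalarTower Z Q K]
    (S : Subalgebra Z K) (hS : OrderType.IsOrder Q S)
    (𝔭 : Ideal S) (h𝔭 : OrderType.IsPrimeOfOrder Q 𝔭) :
    ∃ _ : IsLocalRing (OrderType.completion 𝔭),
      OrderType.IsCohenMacaulay (OrderType.completion 𝔭) ∧
      ringKrullDim (OrderType.completion 𝔭) = 1 ∧
      OrderType.IsCanonicalModule (OrderType.completion 𝔭)
        (OrderType.completedTraceDual Q 𝔭) ∧
      OrderType.cmType (OrderType.completion 𝔭) =
        OrderType.extDim (OrderType.completion 𝔭) (OrderType.completion 𝔭) 1 ∧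
      OrderType.extDim (OrderType.completion 𝔭) (OrderType.completion 𝔭) 1 =
        Module.rank (S ⧸ 𝔭)
          (OrderType.traceDual Q S ⧸ (𝔭 • ⊤ : Submodule S (OrderType.traceDual Q S))) := by
  open OrderType in
  have := hS.finite
  have := hS.projective
  have := hS.isNoetherianRing
  have := hS.projective_ideal 𝔭
  have hprime := h𝔭.isPrime
  obtain ⟨z, hz0, hz⟩ := exists_mem_of_isPrimeOfOrder h𝔭
  have hmax : ∀ P : Ideal S, P.IsPrime → algebraMap Z S z ∈ P → P.IsMaximal :=
    fun P hP hzP => hS.isMaximal_of_mem hz0 hP hzP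
  have : 𝔭.IsMaximal := hmax 𝔭 hprime hz
  have h0 : 𝔭.comap (algebraMap Z S) ≠ ⊥ := fun h => hz0 <| by
    rw [← Ideal.mem_bot, ← h]
    exact hz
  have : (𝔭.comap (algebraMap Z S)).IsMaximal := Ideal.IsPrime.isMaximal inferInstance h0
  have htf := isTorsionFree_of_isFractionRing Z Q K
  have hregK : IsSMulRegular K z := IsSMulRegular.of_ne_zero hz0
  have hreg : algebraMap Z S z ∈ nonZeroDivisors S := by
    rw [mem_nonZeroDivisors_iff_right]
    intro s hs
    refine Subtype.ext (hregK ?_)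
    rw [mul_comm, ← Algebra.smul_def] at hs
    simpa using congrArg Subtype.val hs
  have hregT : IsSMulRegular (traceDual Q S) (algebraMap Z S z) := by
    intro x y hxy
    refine Subtype.ext (hregK ?_)
    have h : z • x = z • y := by simpa only [algebraMap_smul] using hxy
    exact congrArg Subtype.val h
  have hloc := isLocalRing_adicCompletion 𝔭
  have hm := maximalIdeal_adicCompletion 𝔭
  have hnoeth := isNoetherianRing_adicCompletion hz hmax
  have hdim := ringKrullDim_adicCompletion hz hreg hmax
  have : Module.Finite S (traceDual Q S) :=
    have := hS.finite_traceDual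
    Module.Finite.of_restrictScalars_finite Z _ _
  have hdim' : ∀ i : ℕ, (i : WithBot ℕ∞) = ringKrullDim (completion 𝔭) ↔ i = 1 := by
    intro i
    rw [hdim]
    exact_mod_cast Iff.rfl
  refine ⟨hloc, isCohenMacaulay_of_ringKrullDim_eq_one hdim
    (hm ▸ Ideal.mem_map_of_mem _ hz) (algebraMap_mem_nonZeroDivisors_adicCompletion hreg), hdim,
    ⟨inferInstance, fun i hi => ?_, fun i hi => ?_⟩, ?_, ?_⟩
  · rw [(hdim' i).1 hi, extDim_one_baseChange _ (AdicCompletion.evalOneₐ 𝔭) hm]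
    exact hS.rank_homQuotient_traceDual 𝔭 h0 le_rfl
  · match i, mt (hdim' i).2 hi with
    | 0, _ => exact extDim_zero_baseChange _ hm hz hregT
    | 1, h => exact absurd rfl h
    | n + 2, _ =>
      exact extDim_succ_baseChange _ hm (traceDualTrace Q S)
        (existsUnique_traceDualTrace_smul Q S hS) n
  · rw [cmType, hdim]
    rfl
  · rw [← hS.rank_homQuotient_self 𝔭 h0 le_rfl,
      ← extDim_one_baseChange S (AdicCompletion.evalOneₐ 𝔭) hm]
    exact extDim_congr (TensorProduct.AlgebraTensorModule.rid S (completion 𝔭)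
      (completion 𝔭)).symm 1
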